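/- Let $N,N_{RB},N_T,N_{FB}$ be positive integers with $N_{FB}\le N_{RB}$, let $\rho>0$ and $c_1,\dots,c_N>0$. For $1\le k\le N$, $1\le r\le N_{RB}$, $1\le i\le N_T$ let $H_{k,r,i}$ be mutually independent circularly symmetric complex Gaussian variables, $H_{k,r,i}\sim\mathcal{CN}(0,c_k)$ (user $k$, resource block $r$, transmit antenna $i$). With orthogonal space-time block coding (OSTBC) the channel quality information (CQI) of user $k$ on block $r$ is $$Z_{k,r}=\frac1{N_T}\sum_{i=1}^{N_T}|H_{k,r,i}|^2 .$$ Each user feeds back the (non-quantized) CQI of a set of $N_{FB}$ blocks on which its CQI is largest. On each block $r$, among the users who fed back their CQI for that block, one with the largest normalized CQI $Z_{k,r}/c_k$ is scheduled (ties are broken arbitrarily). Let $X_r=\rho Z_{k,r}$ if user $k$ is scheduled on block $r$, and $X_r=0$ if no user fed back its CQI for block $r$. The sum rate is $R=\frac1{N_{RB}}\sum_{r=1}^{N_{RB}}\mathbb E[\log_2(1+X_r)]$. Put $$e_1(a,b,m)=\sum_{\ell=m}^{b-1}\frac{b-\ell}{b}\binom a\ell\binom \ell m(-1)^{\ell-m},$$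 and, for $0\le m\le n(b-1)$, define $e_2(a,b,n,m)$ recursively in $m$ by $$e_2(a,b,n,m)=\begin{cases} e_1(a,b,0)^n, & m=0,\\[2pt] \dfrac{1}{m\,e_1(a,b,0)}\displaystyle\sum_{\ell=1}^{\min\{m,b-1\}}\{(n+1)\ell-m\}\,e_1(a,b,\ell)\,e_2(a,b,n,m-\ell), & 1\le m<n(b-1),\\[2pt] e_1(a,b,b-1)^n, & m=n(b-1),\end{cases}$$ where the middle case is read as $0$ if $e_1(a,b,0)=0$ (for $1\le b\le a$ this happens only if $b=a\ge2$). For positive integers $x,z$ and real $y>0$ put $$C_1(x,y,z)=\frac{z}{(x-1)!\,\ln 2}\sum_{k=0}^{z-1}(-1)^k\binom{z-1}k\sum_{i=0}^{k(x-1)}b_{k,i}\frac{(x+i-1)!}{(k+1)^{x+i}}\sum_{\ell=0}^{x+i-1}\{(k+1)y\}^\ell\,\Gamma(-\ell,(k+1)y)\,e^{(k+1)y},$$ where $\Gamma(a,u)=\int_u^\infty t^{a-1}e^{-t}\,dt$ is the upper incomplete Gamma function and the coefficients $b_{k,i}$, which depend on $x$, are given recursively by $$b_{k,i}=\begin{cases}1,&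 i=0,\\[2pt] \dfrac1i\displaystyle\sum_{n=1}^{\min\{i,x-1\}}\frac{n(k+1)-i}{n!}\,b_{k,i-n},& 1\le i<k(x-1),\\[2pt] \dfrac1{[(x-1)!]^k},& i=k(x-1).\end{cases}$$ Then every $Z_{k,r}$ has the Gamma distribution with shape $N_T$ and rate $N_T/c_k$; every $\log_2(1+X_r)$ is integrable; $R=\mathbb E[\log_2(1+X_r)]$ for every block $r$; and $$R=\frac1N\sum_{k=1}^N\sum_{n=1}^N\binom Nn\Big(\frac{N_{FB}}{N_{RB}}\Big)^n\Big(1-\frac{N_{FB}}{N_{RB}}\Big)^{N-n}\sum_{m=0}^{n(N_{FB}-1)}e_2(N_{RB},N_{FB},n,m)\,C_1\Big(N_T,\frac{N_T}{\rho c_k},nN_{RB}-m\Big),$$ with the convention $0^0=1$. In particular, for full feedback ($N_{FB}=N_{RB}$) $$R=\frac1N\sum_{k=1}^N C_1\Big(N_T,\frac{N_T}{\rho c_k},N\Big),$$ and for best-1 feedback ($N_{FB}=1$) $$R=\frac1N\sum_{k=1}^N\sum_{n=1}^N\binom Nn\Big(\frac1{N_{RB}}\Big)^n\Big(1-\frac1{N_{RB}}\Big)^{N-n}C_1\Big(N_T,\frac{N_T}{\rho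 c_k},nN_{RB}\Big).$$ -/

import Mathlib

open MeasureTheory ProbabilityTheory

noncomputable section

namespace Ostbc

/-- The circularly symmetric complex Gaussian distribution `CN(0, v)`: the real and imaginary parts
are independent real Gaussians with mean `0` and variance `v / 2`. -/
def complexGaussian (v : ℝ) : Measure ℂ :=
  ((gaussianReal 0 (v / 2).toNNReal).prod (gaussianReal 0 (v / 2).toNNReal)).map
    (fun p : ℝ × ℝ => (p.1 : ℂ) + (p.2 : ℂ) * Complex.I)

/-- The OSTBC channel quality information of a block whose channel vector is `h`. -/
def cqi {NT : ℕ} (h : Fin NT → ℂ) : ℝ :=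
  (1 / (NT : ℝ)) * ∑ i, ‖h i‖ ^ 2

/-- `B` is a set of best-`NFB` blocks of a user whose CQI on block `r` is `z r`: it has `NFB`
elements, and no block outside `B` has a larger CQI than a block in `B`. -/
def IsBest {NRB : ℕ} (NFB : ℕ) (z : Fin NRB → ℝ) (B : Finset (Fin NRB)) : Prop :=
  B.card = NFB ∧ ∀ r ∈ B, ∀ r' ∉ B, z r' ≤ z r

/-- `s` is the outcome of largest-normalized-CQI scheduling on one block, where `S` is the set of
users who fed back their CQI for that block, `z k` is the CQI of user `k` on that block, and `c k` is
the mean CQI of user `k`. The outcome `none` is the scheduling outage, which occurs exactly when no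
user fed back the CQI of the block; `some k` means that user `k` is scheduled. -/
def IsScheduled {N : ℕ} (c z : Fin N → ℝ) (S : Set (Fin N)) : Option (Fin N) → Prop
  | none => S = ∅
  | some k => k ∈ S ∧ ∀ j ∈ S, z j / c j ≤ z k / c k

/-- The SNR of the selected user on one block, where `z k` is the CQI of user `k` on that block; it
is `0` when the block is not used. -/
def selectedSnr {N : ℕ} (ρ : ℝ) (z : Fin N → ℝ) : Option (Fin N) → ℝ
  | none => 0
  | some k => ρ * z k

/-- The expected rate `E[log₂ (1 + X)]` of a block on which the SNR of the selected user is `X`. -/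
def blockRate {Ω : Type*} [MeasurableSpace Ω] (P : Measure Ω) (X : Ω → ℝ) : ℝ :=
  ∫ ω, Real.logb 2 (1 + X ω) ∂P

/-- The sum rate, averaged over the resource blocks, where `X r` is the SNR of the user selected on
block `r`. -/
def sumRate {Ω : Type*} [MeasurableSpace Ω] (P : Measure Ω) {NRB : ℕ}
    (X : Fin NRB → Ω → ℝ) : ℝ :=
  (1 / (NRB : ℝ)) * ∑ r, blockRate P (X r)

/-- The coefficients `e₁(NRB, NFB, m)`. -/
def e1 (NRB NFB m : ℕ) : ℝ :=
  ∑ l ∈ Finset.Icc m (NFB - 1),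
    (((NFB : ℝ) - l) / NFB) * (NRB.choose l : ℝ) * (l.choose m : ℝ) * (-1) ^ (l - m)

/-- The coefficients `e₂(NRB, NFB, n, m)`, for `0 ≤ m ≤ n (NFB - 1)` (they are set to `0` for other
`m`). The middle case is `0` when `e₁(NRB, NFB, 0) = 0`, since division by zero gives `0`; for
`1 ≤ NFB ≤ NRB` this happens only if `2 ≤ NFB = NRB`. -/
def e2 (NRB NFB n m : ℕ) : ℝ :=
  if m = 0 then e1 NRB NFB 0 ^ n
  else if m < n * (NFB - 1) then
    (1 / ((m : ℝ) * e1 NRB NFB 0)) *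
      ∑ l ∈ (Finset.Icc 1 (min m (NFB - 1))).attach,
        (((n : ℝ) + 1) * (l.1 : ℝ) - m) * e1 NRB NFB l.1 * e2 NRB NFB n (m - l.1)
  else if m = n * (NFB - 1) then e1 NRB NFB (NFB - 1) ^ n
  else 0
termination_by m
decreasing_by
  have hl := Finset.mem_Icc.mp l.2
  omega

/-- The coefficients `b_{k,i}` with parameter `x ≥ 1`, for `0 ≤ i ≤ k (x - 1)` (they are set to `0`
for other `i`). -/
def bCoeff (x k i : ℕ) : ℝ :=
  if i = 0 then 1
  else if i < k * (x - 1) then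
    (1 / (i : ℝ)) *
      ∑ n ∈ (Finset.Icc 1 (min i (x - 1))).attach,
        (((n.1 : ℝ) * ((k : ℝ) + 1) - i) / (n.1.factorial : ℝ)) * bCoeff x k (i - n.1)
  else if i = k * (x - 1) then 1 / ((x - 1).factorial : ℝ) ^ k
  else 0
termination_by i
decreasing_by
  have hn := Finset.mem_Icc.mp n.2
  omega

/-- The upper incomplete Gamma function `Γ(a, x) = ∫_x^∞ t^(a-1) e^(-t) dt`, used for `x > 0`. -/
def upperGamma (a x : ℝ) : ℝ :=
  ∫ t in Set.Ioi x, t ^ (a - 1) * Real.exp (-t)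

/-- The closed form `C₁(x, y, z)`, for positive integers `x`, `z` and real `y > 0`. -/
def C1 (x : ℕ) (y : ℝ) (z : ℕ) : ℝ :=
  ((z : ℝ) / (((x - 1).factorial : ℝ) * Real.log 2)) *
    ∑ k ∈ Finset.range z, (-1) ^ k * ((z - 1).choose k : ℝ) *
      ∑ i ∈ Finset.range (k * (x - 1) + 1),
        bCoeff x k i * (((x + i - 1).factorial : ℝ) / ((k : ℝ) + 1) ^ (x + i)) *
          ∑ l ∈ Finset.range (x + i),
            (((k : ℝ) + 1) * y) ^ l * upperGamma (-(l : ℝ)) (((k : ℝ) + 1) * y) *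
              Real.exp (((k : ℝ) + 1) * y)

end Ostbc

end

/-! Rescaling user `k`'s CQI by `NT / c k` gives variables `T (k, r)`, i.i.d. over users and blocks
with the Gamma law of shape `NT` and rate one, and the scheduled SNR becomes `T (k, r) / y k` with
`y k = NT / (ρ * c k)`. Almost surely no two of these tie, so a block is fed back exactly when fewer
than `NFB` blocks of that user beat it, and the arbitrary tie-breaking rules are irrelevant.

Write `u` for the distribution function of `T` at `t`, `p = NFB / NRB`, `q(u)` for `exceedanceProb`
and `Q(u)` for `feedbackCdf`. If `l < NFB` of a user's blocks exceed `t`, a fraction `(NFB - l) /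
NFB` of the blocks it feeds back lies below `t`, which explains the weights in `Q`. Given `T (k, r)
= t`, user `k` feeds back with probability `q(u)`, and each other user independently fails to beat
it with probability `1 - p (1 - Q(u))`. Hence the value of `T (k, r)`, on the event that `k` is
scheduled, has density `q (1 - p (1 - Q)) ^ (N - 1)` with respect to the Gamma law.

Since `Q' = q / p`, this is `1 / N` times the derivative in `u` of `(1 - p + p Q) ^ N`. The binomial
theorem and the expansion of `Q ^ n` in powers `u ^ (n * NRB - m)` with coefficients `e2` turn it
into a combination of the derivatives `z u ^ (z - 1)`, each the density factor of the maximum of `z`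
independent Gamma variables. The expected rate of such a maximum is `C1` (`C1_eq_integral`), by
expanding `(1 - erlangTail) ^ (z - 1)` with the coefficients `bCoeff` and integrating by parts. The
resulting value does not depend on the block, so the average over blocks equals each block rate. -/

namespace Ostbc

/-! ### Coefficients of powers of polynomials: the recursions for `bCoeff` and `e2` -/

section PowerCoefficients

open Polynomial

/-- The recursion for the coefficients of a power of a polynomial. -/
theorem coeff_pow_recursion (p : ℝ[X]) (n m : ℕ) :
    (m : ℝ) * p.coeff 0 * (p ^ n).coeff m =
      ∑ l ∈ Finset.Icc 1 m, (((n : ℝ) + 1) * l - m) * p.coeff l * (p ^ n).coeff (m - l) := by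
  have hθ : ∀ (q : ℝ[X]) (i : ℕ), (X * derivative q).coeff i = i * q.coeff i := by
    intro q i
    cases i with
    | zero => simp
    | succ i => rw [coeff_X_mul, coeff_derivative]; push_cast; ring
  -- This is `p (p ^ n)' = n p' p ^ n`. The extra factor `X` makes differentiation multiply the
  -- `i`-th coefficient by `i` without shifting it; the recursion is the comparison of `m`-th
  -- coefficients.
  have hid : p * (X * derivative (p ^ n)) = C (n : ℝ) * ((X * derivative p) * p ^ n) := by
    rcases n with _ | n
    · simp
    · rw [derivative_pow]
      simp only [Nat.add_sub_cancel, pow_succ]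
      ring
  have hc := congrArg (fun q => q.coeff m) hid
  simp only [coeff_C_mul, coeff_mul p, coeff_mul (X * derivative p), hθ,
    Finset.Nat.sum_antidiagonal_eq_sum_range_succ_mk] at hc
  rw [Finset.sum_range_succ', Finset.sum_range_succ'] at hc
  have hIcc : Finset.Icc 1 m = (Finset.range m).map (addRightEmbedding 1) := by
    ext i
    simp only [Finset.mem_Icc, Finset.mem_map, Finset.mem_range, addRightEmbedding_apply]
    exact ⟨fun h => ⟨i - 1, by omega, by omega⟩, fun ⟨j, hj, h⟩ => by omega⟩
  rw [hIcc, Finset.sum_map]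
  simp only [addRightEmbedding_apply]
  have hsplit : ∀ i ∈ Finset.range m,
      (((n : ℝ) + 1) * ((i + 1 : ℕ) : ℝ) - m) * p.coeff (i + 1) * (p ^ n).coeff (m - (i + 1)) =
        n * (((i + 1 : ℕ) : ℝ) * p.coeff (i + 1) * (p ^ n).coeff (m - (i + 1))) -
          p.coeff (i + 1) * (((m - (i + 1) : ℕ) : ℝ) * (p ^ n).coeff (m - (i + 1))) := by
    intro i hi
    rw [Nat.cast_sub (by simpa using hi)]
    push_cast
    ring
  rw [Finset.sum_congr rfl hsplit, Finset.sum_sub_distrib, ← Finset.mul_sum]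
  simp only [Nat.cast_zero, zero_mul, add_zero, Nat.sub_zero] at hc
  linear_combination hc

theorem coeff_pow_recursion_of_natDegree_le (p : ℝ[X]) {d : ℕ} (hd : p.natDegree ≤ d) (n m : ℕ) :
    (m : ℝ) * p.coeff 0 * (p ^ n).coeff m =
      ∑ l ∈ Finset.Icc 1 (min m d),
        (((n : ℝ) + 1) * l - m) * p.coeff l * (p ^ n).coeff (m - l) := by
  rw [coeff_pow_recursion]
  symm
  refine Finset.sum_subset (Finset.Icc_subset_Icc_right (min_le_left _ _)) fun l hl hl' => ?_
  rw [coeff_eq_zero_of_natDegree_lt (n := l)]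
  · ring
  · simp only [Finset.mem_Icc] at hl hl'
    omega

/-- The polynomial with coefficients `c 0, …, c d`. -/
noncomputable def ofCoeffs (c : ℕ → ℝ) (d : ℕ) : ℝ[X] :=
  ∑ l ∈ Finset.range (d + 1), C (c l) * X ^ l

theorem coeff_ofCoeffs (c : ℕ → ℝ) (d : ℕ) {l : ℕ} (hl : l ≤ d) : (ofCoeffs c d).coeff l = c l := by
  rw [ofCoeffs, finsetSum_coeff]
  simp only [coeff_C_mul_X_pow]
  rw [Finset.sum_ite_eq, if_pos (by simpa using Nat.lt_succ_of_le hl)]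

theorem natDegree_ofCoeffs_le (c : ℕ → ℝ) (d : ℕ) : (ofCoeffs c d).natDegree ≤ d :=
  natDegree_sum_le_of_forall_le _ _ fun l hl =>
    (natDegree_C_mul_X_pow_le _ _).trans (by simpa [Nat.lt_succ_iff] using hl)

theorem eval_ofCoeffs (c : ℕ → ℝ) (d : ℕ) (u : ℝ) :
    (ofCoeffs c d).eval u = ∑ l ∈ Finset.range (d + 1), c l * u ^ l := by
  simp [ofCoeffs, eval_finsetSum]

theorem eval_ofCoeffs_pow (c : ℕ → ℝ) (d n : ℕ) (u : ℝ) :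
    (∑ l ∈ Finset.range (d + 1), c l * u ^ l) ^ n =
      ∑ m ∈ Finset.range (n * d + 1), (ofCoeffs c d ^ n).coeff m * u ^ m := by
  rw [← eval_ofCoeffs, ← eval_pow]
  refine eval_eq_sum_range' (Nat.lt_succ_of_le ?_) u
  exact natDegree_pow_le.trans (Nat.mul_le_mul_left _ (natDegree_ofCoeffs_le c d))

theorem coeff_ofCoeffs_pow_top (c : ℕ → ℝ) (d n : ℕ) :
    (ofCoeffs c d ^ n).coeff (n * d) = c d ^ n := by
  rw [coeff_pow_of_natDegree_le (natDegree_ofCoeffs_le c d), coeff_ofCoeffs c d le_rfl]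

theorem coeff_ofCoeffs_pow (c : ℕ → ℝ) (d : ℕ) (h0 : c 0 ≠ 0) (n : ℕ) {m : ℕ} (hm : m ≠ 0) :
    (ofCoeffs c d ^ n).coeff m = (1 / ((m : ℝ) * c 0)) *
      ∑ l ∈ Finset.Icc 1 (min m d),
        (((n : ℝ) + 1) * l - m) * c l * (ofCoeffs c d ^ n).coeff (m - l) := by
  have h := coeff_pow_recursion_of_natDegree_le _ (natDegree_ofCoeffs_le c d) n m
  have hs : ∀ l ∈ Finset.Icc 1 (min m d),
      (((n : ℝ) + 1) * l - m) * (ofCoeffs c d).coeff l * (ofCoeffs c d ^ n).coeff (m - l) =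
        (((n : ℝ) + 1) * l - m) * c l * (ofCoeffs c d ^ n).coeff (m - l) := by
    intro l hl
    rw [coeff_ofCoeffs c d ((Finset.mem_Icc.mp hl).2.trans (min_le_right _ _))]
  rw [Finset.sum_congr rfl hs, coeff_ofCoeffs c d (Nat.zero_le _)] at h
  have hm' : (m : ℝ) ≠ 0 := Nat.cast_ne_zero.mpr hm
  rw [← h]
  field_simp

theorem bCoeff_eq_coeff (x k i : ℕ) (hi : i ≤ k * (x - 1)) :
    bCoeff x k i = (ofCoeffs (fun l => 1 / (l.factorial : ℝ)) (x - 1) ^ k).coeff i := by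
  induction i using Nat.strong_induction_on with
  | _ i ih =>
    rw [bCoeff]
    split_ifs with h0 h1 h2
    · subst h0
      rw [coeff_zero_eq_eval_zero, eval_pow, ← coeff_zero_eq_eval_zero,
        coeff_ofCoeffs _ _ (Nat.zero_le _)]
      simp
    · rw [coeff_ofCoeffs_pow _ _ (by simp) k h0,
        Finset.sum_attach _ (fun n : ℕ => (((n : ℝ) * ((k : ℝ) + 1) - i) / (n.factorial : ℝ)) *
          bCoeff x k (i - n))]
      simp only [Nat.factorial_zero, Nat.cast_one, div_one, mul_one]
      congr 1
      refine Finset.sum_congr rfl fun n hn => ?_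
      have hn' := Finset.mem_Icc.mp hn
      rw [ih (i - n) (by omega) (by omega)]
      ring
    · subst h2
      rw [coeff_ofCoeffs_pow_top, div_pow, one_pow]
    · omega

theorem pow_sum_eq_sum_bCoeff (x k : ℕ) (hx : 1 ≤ x) (t : ℝ) :
    (∑ l ∈ Finset.range x, t ^ l / (l.factorial : ℝ)) ^ k =
      ∑ i ∈ Finset.range (k * (x - 1) + 1), bCoeff x k i * t ^ i := by
  have h := eval_ofCoeffs_pow (fun l => 1 / (l.factorial : ℝ)) (x - 1) k t
  rw [Nat.sub_add_cancel hx] at h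
  calc _ = (∑ l ∈ Finset.range x, 1 / (l.factorial : ℝ) * t ^ l) ^ k := by
        congr 1
        exact Finset.sum_congr rfl fun l _ => by ring
    _ = _ := by
        rw [h]
        refine Finset.sum_congr rfl fun i hi => ?_
        rw [bCoeff_eq_coeff x k i (by simpa [Nat.lt_succ_iff] using hi)]

/-- The recursion determines the coefficients only when the constant term is nonzero, since it
divides by it; full feedback needs a separate treatment. -/
theorem e2_eq_coeff (a b n m : ℕ) (h0 : e1 a b 0 ≠ 0) (hm : m ≤ n * (b - 1)) :
    e2 a b n m = (ofCoeffs (e1 a b) (b - 1) ^ n).coeff m := by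
  induction m using Nat.strong_induction_on with
  | _ m ih =>
    rw [e2]
    split_ifs with hm0 h1 h2
    · subst hm0
      rw [coeff_zero_eq_eval_zero, eval_pow, ← coeff_zero_eq_eval_zero,
        coeff_ofCoeffs _ _ (Nat.zero_le _)]
    · rw [coeff_ofCoeffs_pow _ _ h0 n hm0,
        Finset.sum_attach _ (fun l : ℕ => (((n : ℝ) + 1) * (l : ℝ) - m) * e1 a b l *
          e2 a b n (m - l))]
      congr 1
      refine Finset.sum_congr rfl fun l hl => ?_
      have hl' := Finset.mem_Icc.mp hl
      rw [ih (m - l) (by omega) (by omega)]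
    · subst h2
      rw [coeff_ofCoeffs_pow_top]
    · omega

end PowerCoefficients

/-! ### Polynomial identities for the feedback probabilities -/

section Feedback

/-- The conditional distribution function of the CQI of a block that is fed back, as a function of
the value `u` of the distribution function of the CQI. -/
noncomputable def feedbackCdf (a b : ℕ) (u : ℝ) : ℝ :=
  ∑ l ∈ Finset.range b,
    ((b : ℝ) - l) / b * (a.choose l : ℝ) * (u ^ (a - l) * (1 - u) ^ l)

/-- The probability that fewer than `b` of `n` independent blocks have a CQI beyond its `u`-quantile. -/
noncomputable def exceedanceProb (n b : ℕ) (u : ℝ) : ℝ :=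
  ∑ l ∈ Finset.range b, (n.choose l : ℝ) * (u ^ (n - l) * (1 - u) ^ l)

/-- Real subtraction keeps the identity valid for every `l`: both sides vanish once `l > n`. -/
theorem sub_mul_choose_succ (n l : ℕ) :
    ((n : ℝ) + 1 - l) * ((n + 1).choose l : ℝ) = (n + 1) * (n.choose l : ℝ) := by
  rcases le_or_gt l (n + 1) with hl | hl
  · have h := Nat.choose_mul_succ_eq n l
    have h' : ((n.choose l * (n + 1) : ℕ) : ℝ) = (((n + 1).choose l * (n + 1 - l) : ℕ) : ℝ) := by
      rw [h]
    push_cast [Nat.cast_sub hl] at h'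
    linarith
  · rw [Nat.choose_eq_zero_of_lt hl, Nat.choose_eq_zero_of_lt (by omega)]
    simp

theorem hasDerivAt_bernstein (n l : ℕ) (u : ℝ) :
    HasDerivAt (fun u : ℝ => ((n + 1).choose (l + 1) : ℝ) * (u ^ (n + 1 - (l + 1)) * (1 - u) ^ (l + 1)))
      ((n + 1) * ((n.choose (l + 1) : ℝ) * (u ^ (n - (l + 1)) * (1 - u) ^ (l + 1)) -
        (n.choose l : ℝ) * (u ^ (n - l) * (1 - u) ^ l))) u := by
  have h1 : HasDerivAt (fun u : ℝ => 1 - u) (-1) u := by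
    simpa using (hasDerivAt_id u).const_sub 1
  have h2 := ((hasDerivAt_pow (n - l) u).mul (h1.pow (l + 1))).const_mul
    ((n + 1).choose (l + 1) : ℝ)
  rw [Nat.add_sub_add_right]
  refine h2.congr_deriv ?_
  have hs := sub_mul_choose_succ n (l + 1)
  have hs2 : ((l : ℝ) + 1) * ((n + 1).choose (l + 1) : ℝ) = (n + 1) * (n.choose l : ℝ) := by
    have := Nat.add_one_mul_choose_eq n l
    have h' : (((n + 1) * n.choose l : ℕ) : ℝ) = (((n + 1).choose (l + 1) * (l + 1) : ℕ) : ℝ) := by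
      rw [this]
    push_cast at h'
    linarith
  have hcast : ((n - l : ℕ) : ℝ) * ((n + 1).choose (l + 1) : ℝ) =
      (n + 1) * (n.choose (l + 1) : ℝ) := by
    rcases le_or_gt l n with h | h
    · rw [Nat.cast_sub h]
      push_cast at hs
      linear_combination hs
    · rw [Nat.choose_eq_zero_of_lt (by omega : n + 1 < l + 1),
        Nat.choose_eq_zero_of_lt (by omega : n < l + 1)]
      simp
  rw [show n - l - 1 = n - (l + 1) by omega]
  push_cast
  simp only [Pi.pow_apply]
  linear_combination (u ^ (n - (l + 1)) * (1 - u) ^ (l + 1)) * hcast -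
    (u ^ (n - l) * (1 - u) ^ l) * hs2

/-- The derivatives of the Bernstein terms are differences of consecutive terms of degree `n`. Abel
summation moves the differences onto the weights `(b - l) / b`, which drop by `1 / b` at each step.
-/
theorem hasDerivAt_feedbackCdf (n b : ℕ) (hb : 1 ≤ b) (u : ℝ) :
    HasDerivAt (feedbackCdf (n + 1) b) (((n : ℝ) + 1) / b * exceedanceProb n b u) u := by
  have hb0 : (b : ℝ) ≠ 0 := by positivity
  set g : ℕ → ℝ := fun l => (n.choose l : ℝ) * (u ^ (n - l) * (1 - u) ^ l) with hg
  set d : ℕ → ℝ := fun l => match l with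
    | 0 => (n + 1) * g 0
    | l + 1 => (n + 1) * (g (l + 1) - g l) with hd
  have hterm : ∀ l, HasDerivAt
      (fun u : ℝ => ((n + 1).choose l : ℝ) * (u ^ (n + 1 - l) * (1 - u) ^ l)) (d l) u := by
    intro l
    cases l with
    | zero =>
      have := hasDerivAt_pow (n + 1) u
      simp only [Nat.choose_zero_right, Nat.cast_one, Nat.sub_zero, pow_zero, mul_one, one_mul,
        hd, hg]
      simpa using this
    | succ l => exact hasDerivAt_bernstein n l u
  have hsum : HasDerivAt (feedbackCdf (n + 1) b)
      (∑ l ∈ Finset.range b, ((b : ℝ) - l) / b * d l) u := by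
    have := HasDerivAt.fun_sum (u := Finset.range b)
      (fun l _ => (hterm l).const_mul (((b : ℝ) - l) / b))
    refine this.congr_of_eventuallyEq (Filter.Eventually.of_forall fun v => ?_)
    simp only [feedbackCdf]
    refine Finset.sum_congr rfl fun l _ => ?_
    ring
  refine hsum.congr_deriv ?_
  -- Summation by parts with the boundary term kept, so that induction on `B` works; that term
  -- vanishes at `B = b`.
  have hkey : ∀ B : ℕ, ∑ l ∈ Finset.range B, ((b : ℝ) - l) * d l =
      (n + 1) * ((∑ l ∈ Finset.range B, g l) + ((b : ℝ) - B) * (if B = 0 then 0 else g (B - 1))) := by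
    intro B
    induction B with
    | zero => simp
    | succ B ihB =>
      rw [Finset.sum_range_succ, Finset.sum_range_succ, ihB]
      cases B with
      | zero => simp [hd]; ring
      | succ B => simp [hd]; ring
  have := hkey b
  rw [sub_self, zero_mul, add_zero] at this
  simp only [exceedanceProb]
  rw [← hg]
  calc ∑ l ∈ Finset.range b, ((b : ℝ) - l) / b * d l
      = (∑ l ∈ Finset.range b, ((b : ℝ) - l) * d l) / b := by
        rw [Finset.sum_div]
        exact Finset.sum_congr rfl fun l _ => by ring
    _ = _ := by rw [this]; ring

theorem feedbackCdf_one (a b : ℕ) (hb : 1 ≤ b) : feedbackCdf a b 1 = 1 := by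
  rw [feedbackCdf, Finset.sum_eq_single 0]
  · have : (b : ℝ) ≠ 0 := by positivity
    simp [this]
  · intro l _ hl
    simp [hl]
  · intro h
    simp at h
    omega

theorem feedbackCdf_eq_sum_e1 (a b : ℕ) (hb : 1 ≤ b) (hba : b ≤ a) (u : ℝ) :
    feedbackCdf a b u = ∑ m ∈ Finset.range (b - 1 + 1), e1 a b m * u ^ (a - m) := by
  have hexp : ∀ l ∈ Finset.range b, u ^ (a - l) * (1 - u) ^ l =
      ∑ m ∈ Finset.range (l + 1), (-1) ^ (l - m) * (l.choose m : ℝ) * u ^ (a - m) := by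
    intro l hl
    have hl' := Finset.mem_range.mp hl
    rw [show (1 : ℝ) - u = 1 + (-u) by ring, add_pow, Finset.mul_sum]
    refine Finset.sum_congr rfl fun m hm => ?_
    have hm' := Finset.mem_range.mp hm
    rw [neg_pow, show a - m = (a - l) + (l - m) by omega, pow_add]
    ring
  rw [feedbackCdf, Nat.sub_add_cancel hb]
  simp only [e1, Finset.sum_mul]
  rw [Finset.sum_congr rfl fun l hl => by rw [hexp l hl, Finset.mul_sum]]
  rw [Finset.sum_sigma', Finset.sum_sigma']
  refine Finset.sum_bij' (fun p _ => ⟨p.2, p.1⟩) (fun p _ => ⟨p.2, p.1⟩) ?_ ?_ ?_ ?_ ?_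
  · rintro ⟨l, m⟩ h
    simp only [Finset.mem_sigma, Finset.mem_range, Finset.mem_Icc] at h ⊢
    omega
  · rintro ⟨l, m⟩ h
    simp only [Finset.mem_sigma, Finset.mem_range, Finset.mem_Icc] at h ⊢
    omega
  · intros; rfl
  · intros; rfl
  · rintro ⟨l, m⟩ h
    ring

theorem sum_range_choose_mul_neg_one_pow (n j : ℕ) :
    ∑ l ∈ Finset.range (j + 1), ((n + 1).choose l : ℝ) * (-1) ^ l = (-1) ^ j * (n.choose j : ℝ) := by
  induction j with
  | zero => simp
  | succ j ih =>
    rw [Finset.sum_range_succ, ih, Nat.choose_succ_succ]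
    push_cast
    ring

/-- Two alternating summations give the closed form `(-1) ^ (b - 1) * (a - 2).choose (b - 1) / b`,
nonzero precisely because `b - 1 ≤ a - 2`. -/
theorem e1_zero_ne_zero (a b : ℕ) (hb : 1 ≤ b) (hba : b < a) : e1 a b 0 ≠ 0 := by
  obtain ⟨n, rfl⟩ : ∃ n, a = n + 2 := ⟨a - 2, by omega⟩
  have hb0 : (b : ℝ) ≠ 0 := by positivity
  have habel : ∀ B : ℕ, ∑ l ∈ Finset.range B, ((B : ℝ) - l) * (((n + 2).choose l : ℝ) * (-1) ^ l) =
      ∑ j ∈ Finset.range B, ((n + 1).choose j : ℝ) * (-1) ^ j := by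
    intro B
    induction B with
    | zero => simp
    | succ B ih =>
      have hB := sum_range_choose_mul_neg_one_pow (n + 1) B
      rw [Finset.sum_range_succ] at hB
      have hs : ∑ l ∈ Finset.range B, (((B + 1 : ℕ) : ℝ) - l) * (((n + 2).choose l : ℝ) * (-1) ^ l) =
          ∑ l ∈ Finset.range B, ((B : ℝ) - l) * (((n + 2).choose l : ℝ) * (-1) ^ l) +
            ∑ l ∈ Finset.range B, ((n + 1 + 1).choose l : ℝ) * (-1) ^ l := by
        rw [← Finset.sum_add_distrib]
        refine Finset.sum_congr rfl fun l _ => ?_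
        push_cast
        ring
      rw [Finset.sum_range_succ _ B, Finset.sum_range_succ _ B, ← ih, hs]
      push_cast
      linear_combination hB
  have h : e1 (n + 2) b 0 = (-1) ^ (b - 1) * (n.choose (b - 1) : ℝ) / b := by
    rw [← sum_range_choose_mul_neg_one_pow, Nat.sub_add_cancel hb, ← habel, Finset.sum_div, e1]
    refine Finset.sum_congr ?_ fun l _ => ?_
    · ext l
      simp only [Finset.mem_Icc, Finset.mem_range]
      omega
    · simp
      ring
  rw [h]
  have : (n.choose (b - 1) : ℝ) ≠ 0 := Nat.cast_ne_zero.mpr (Nat.choose_pos (by omega)).ne'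
  positivity

/-- When every block is fed back, conditioning on feedback changes nothing. Algebraically, the
weight turns `a.choose l` into `(a - 1).choose l`, and the binomial theorem sums the rest to one. -/
theorem feedbackCdf_self (a : ℕ) (ha : 1 ≤ a) (u : ℝ) : feedbackCdf a a u = u := by
  obtain ⟨n, rfl⟩ : ∃ n, a = n + 1 := ⟨a - 1, by omega⟩
  have hn : (n : ℝ) + 1 ≠ 0 := by positivity
  have h : feedbackCdf (n + 1) (n + 1) u =
      u * ∑ l ∈ Finset.range (n + 1), (1 - u) ^ l * u ^ (n - l) * (n.choose l : ℝ) := by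
    rw [feedbackCdf, Finset.mul_sum]
    refine Finset.sum_congr rfl fun l hl => ?_
    have hl' := Finset.mem_range.mp hl
    have := sub_mul_choose_succ n l
    rw [show n + 1 - l = (n - l) + 1 by omega, pow_succ]
    push_cast
    field_simp
    linear_combination (u ^ (n - l) * u * (1 - u) ^ l) * this
  rw [h, ← add_pow]
  simp

theorem e1_self_top (a : ℕ) (ha : 1 ≤ a) : e1 a a (a - 1) = 1 := by
  obtain ⟨n, rfl⟩ : ∃ n, a = n + 1 := ⟨a - 1, by omega⟩
  have hn : (n : ℝ) + 1 ≠ 0 := by positivity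
  simp [e1]
  field_simp

theorem e1_self_zero (a : ℕ) (ha : 2 ≤ a) : e1 a a 0 = 0 := by
  obtain ⟨n, rfl⟩ : ∃ n, a = n + 2 := ⟨a - 2, by omega⟩
  have hn : (n : ℝ) + 1 + 1 ≠ 0 := by positivity
  have h1 : e1 (n + 2) (n + 2) 0 = ∑ l ∈ Finset.range (n + 1 + 1), ((n + 1).choose l : ℝ) * (-1) ^ l := by
    rw [e1]
    refine Finset.sum_congr ?_ fun l _ => ?_
    · ext l
      simp only [Finset.mem_Icc, Finset.mem_range]
      omega
    · have := sub_mul_choose_succ (n + 1) l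
      push_cast at this
      simp only [Nat.choose_zero_right, Nat.sub_zero]
      push_cast
      field_simp
      rw [show (n : ℝ) + 2 = n + 1 + 1 by ring]
      linear_combination this
  rw [h1, sum_range_choose_mul_neg_one_pow]
  simp

/-- Matches `Q(u) = u`: for `a ≥ 2` the constant `e1` vanishes, so the clause `m = 0` gives `0 ^ n =
0`, the middle clause is zero by division by zero, and only the top clause survives. For `a = 1` the
bottom and the top coincide. -/
theorem e2_self (a n m : ℕ) (ha : 1 ≤ a) (hn : 1 ≤ n) (hm : m ≤ n * (a - 1)) :
    e2 a a n m = if m = n * (a - 1) then 1 else 0 := by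
  rcases eq_or_lt_of_le ha with rfl | ha2
  · have : m = 0 := by simpa using hm
    subst this
    have h1 := e1_self_top 1 le_rfl
    rw [e2]
    simp at h1
    simp [h1]
  · have h0 := e1_self_zero a ha2
    have htop : n * (a - 1) ≠ 0 := by
      have : 0 < n * (a - 1) := Nat.mul_pos hn (by omega)
      omega
    rw [e2]
    split_ifs with h1 h2 h3 h4
    · omega
    · rw [h0, zero_pow (by omega)]
    · omega
    · simp [h0]
    · rw [e1_self_top a ha, one_pow]
    · rfl

/-- The powers of the conditional distribution function, expanded with the coefficients `e₂`. -/
theorem feedbackCdf_pow (a b n : ℕ) (hb : 1 ≤ b) (hba : b ≤ a) (hn : 1 ≤ n) (u : ℝ) (hu : 0 < u) :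
    feedbackCdf a b u ^ n =
      ∑ m ∈ Finset.range (n * (b - 1) + 1), e2 a b n m * u ^ (n * a - m) := by
  rcases eq_or_lt_of_le hba with rfl | hlt
  · rw [feedbackCdf_self _ hb, Finset.sum_eq_single (n * (b - 1))]
    · rw [e2_self b n _ hb hn le_rfl, if_pos rfl, one_mul]
      congr 1
      obtain ⟨c, rfl⟩ : ∃ c, b = c + 1 := ⟨b - 1, by omega⟩
      simp [Nat.mul_add]
    · intro m hm hne
      rw [e2_self b n _ hb hn (by simpa [Nat.lt_succ_iff] using hm), if_neg hne, zero_mul]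
    · simp
  · have hle : n * (b - 1) ≤ n * a := Nat.mul_le_mul_left _ (by omega)
    -- Factoring out `u ^ a` leaves a polynomial in `u⁻¹` whose constant term is `e1 a b 0`; this is
    -- where `u ≠ 0` is needed.
    have hp : ∀ (A m : ℕ), m ≤ A → u ^ (A - m) = u ^ A * (u⁻¹) ^ m := by
      intro A m h
      rw [inv_pow, pow_sub₀ u hu.ne' h]
    have h1 : feedbackCdf a b u =
        u ^ a * ∑ m ∈ Finset.range (b - 1 + 1), e1 a b m * (u⁻¹) ^ m := by
      rw [feedbackCdf_eq_sum_e1 a b hb hba, Finset.mul_sum]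
      refine Finset.sum_congr rfl fun m hm => ?_
      have := Finset.mem_range.mp hm
      rw [hp a m (by omega)]
      ring
    rw [h1, mul_pow, eval_ofCoeffs_pow, ← pow_mul, mul_comm a n, Finset.mul_sum]
    refine Finset.sum_congr rfl fun m hm => ?_
    have hm' := Finset.mem_range.mp hm
    rw [hp _ m (by omega), e2_eq_coeff a b n m (e1_zero_ne_zero a b hb hlt) (by omega)]
    ring

/-- The density of the CQI of the scheduled user, expanded with the coefficients `e₂`. -/
theorem exceedanceProb_mul_pow (a b N : ℕ) (hb : 1 ≤ b) (hba : b ≤ a) (hN : 1 ≤ N) (u : ℝ)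
    (hu : 0 < u) :
    exceedanceProb (a - 1) b u * (1 - (b : ℝ) / a * (1 - feedbackCdf a b u)) ^ (N - 1) =
      (1 / (N : ℝ)) * ∑ n ∈ Finset.Icc 1 N,
        (N.choose n : ℝ) * ((b : ℝ) / a) ^ n * (1 - (b : ℝ) / a) ^ (N - n) *
          ∑ m ∈ Finset.range (n * (b - 1) + 1),
            e2 a b n m * (((n * a - m : ℕ) : ℝ) * u ^ (n * a - m - 1)) := by
  have ha0 : (a : ℝ) ≠ 0 := Nat.cast_ne_zero.mpr (by omega)
  have hb0 : (b : ℝ) ≠ 0 := Nat.cast_ne_zero.mpr (by omega)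
  have hN0 : (N : ℝ) ≠ 0 := Nat.cast_ne_zero.mpr (by omega)
  set p : ℝ := (b : ℝ) / a with hp
  have hQ : HasDerivAt (feedbackCdf a b) ((a : ℝ) / b * exceedanceProb (a - 1) b u) u := by
    obtain ⟨n, rfl⟩ : ∃ n, a = n + 1 := ⟨a - 1, by omega⟩
    have := hasDerivAt_feedbackCdf n b hb u
    simpa using this
  -- The same function is differentiated twice, by the chain rule and after expansion; uniqueness of
  -- the derivative gives the identity. The expansion is known for positive arguments only, hence an
  -- equality near `u`.
  have h1 : HasDerivAt (fun v => (1 - p * (1 - feedbackCdf a b v)) ^ N)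
      ((N : ℝ) * (1 - p * (1 - feedbackCdf a b u)) ^ (N - 1) * exceedanceProb (a - 1) b u) u := by
    have := (((hQ.const_sub 1).const_mul p).const_sub 1).pow N
    refine this.congr_deriv ?_
    rw [hp]
    field_simp
  have h2 : HasDerivAt (fun v => (1 - p) ^ N + ∑ n ∈ Finset.Icc 1 N,
        (N.choose n : ℝ) * p ^ n * (1 - p) ^ (N - n) *
          ∑ m ∈ Finset.range (n * (b - 1) + 1), e2 a b n m * v ^ (n * a - m))
      (∑ n ∈ Finset.Icc 1 N, (N.choose n : ℝ) * p ^ n * (1 - p) ^ (N - n) *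
          ∑ m ∈ Finset.range (n * (b - 1) + 1),
            e2 a b n m * (((n * a - m : ℕ) : ℝ) * u ^ (n * a - m - 1))) u := by
    refine HasDerivAt.const_add _ (HasDerivAt.fun_sum fun n _ => HasDerivAt.const_mul _ ?_)
    exact HasDerivAt.fun_sum fun m _ => (hasDerivAt_pow _ u).const_mul _
  have heq : (fun v => (1 - p * (1 - feedbackCdf a b v)) ^ N) =ᶠ[nhds u]
      (fun v => (1 - p) ^ N + ∑ n ∈ Finset.Icc 1 N,
        (N.choose n : ℝ) * p ^ n * (1 - p) ^ (N - n) *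
          ∑ m ∈ Finset.range (n * (b - 1) + 1), e2 a b n m * v ^ (n * a - m)) := by
    filter_upwards [lt_mem_nhds hu] with v hv
    rw [show 1 - p * (1 - feedbackCdf a b v) = p * feedbackCdf a b v + (1 - p) by ring, add_pow,
      Finset.sum_range_eq_add_Ico _ (by omega)]
    congr 1
    · simp
    · refine Finset.sum_congr (by ext; simp) fun n hn => ?_
      rw [← feedbackCdf_pow a b n hb hba (by simp at hn; omega) v hv, mul_pow]
      ring
  have := (h1.congr_of_eventuallyEq heq.symm).unique h2
  rw [← this]
  field_simp

end Feedback

/-! ### The Erlang tail and elementary Gamma integrals -/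

section Erlang

open Filter Topology Set

/-- The probability that a Gamma variable with integer shape `x` and rate `1` exceeds `t`. -/
noncomputable def erlangTail (x : ℕ) (t : ℝ) : ℝ :=
  Real.exp (-t) * ∑ l ∈ Finset.range x, t ^ l / (l.factorial : ℝ)

theorem hasDerivAt_erlangTail (n : ℕ) (t : ℝ) :
    HasDerivAt (erlangTail (n + 1)) (-(t ^ n * Real.exp (-t) / (n.factorial : ℝ))) t := by
  have hexp : HasDerivAt (fun t : ℝ => Real.exp (-t)) (-Real.exp (-t)) t := by
    simpa using (hasDerivAt_neg t).exp
  induction n with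
  | zero =>
    refine (hexp.congr_of_eventuallyEq (Eventually.of_forall fun s => ?_)).congr_deriv ?_ <;>
      simp [erlangTail]
  | succ n ih =>
    have h := ih.add (hexp.mul ((hasDerivAt_pow (n + 1) t).div_const ((n + 1).factorial : ℝ)))
    refine (h.congr_of_eventuallyEq (Eventually.of_forall fun s => ?_)).congr_deriv ?_
    · simp only [erlangTail, Pi.add_apply, Pi.mul_apply]
      rw [Finset.sum_range_succ _ (n + 1)]
      ring
    · have h1 : (n.factorial : ℝ) ≠ 0 := by positivity
      simp only [Nat.factorial_succ, Nat.cast_mul, Nat.add_sub_cancel]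
      push_cast
      field_simp
      ring

theorem erlangTail_zero (n : ℕ) : erlangTail (n + 1) 0 = 1 := by
  rw [erlangTail, Finset.sum_range_succ']
  simp

theorem erlangTail_nonneg (x : ℕ) {t : ℝ} (ht : 0 ≤ t) : 0 ≤ erlangTail x t := by
  unfold erlangTail
  positivity

theorem continuous_erlangTail (x : ℕ) : Continuous (erlangTail x) := by
  unfold erlangTail
  fun_prop

theorem tendsto_pow_mul_erlangTail (x n : ℕ) :
    Tendsto (fun t => t ^ n * erlangTail x t) atTop (𝓝 0) := by
  have h : Tendsto (fun t : ℝ => ∑ l ∈ Finset.range x,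
      (t ^ (n + l) * Real.exp (-t)) / (l.factorial : ℝ)) atTop
      (𝓝 (∑ l ∈ Finset.range x, 0 / (l.factorial : ℝ))) :=
    tendsto_finsetSum _ fun l _ =>
      (Real.tendsto_pow_mul_exp_neg_atTop_nhds_zero (n + l)).div_const _
  simp only [zero_div, Finset.sum_const_zero] at h
  refine h.congr fun t => ?_
  rw [erlangTail, Finset.mul_sum, Finset.mul_sum]
  refine Finset.sum_congr rfl fun l _ => ?_
  rw [pow_add]
  ring

theorem integrableOn_pow_mul_exp_neg (n : ℕ) :
    IntegrableOn (fun t : ℝ => t ^ n * Real.exp (-t)) (Ioi 0) := by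
  have h := Real.GammaIntegral_convergent (s := n + 1) (by positivity)
  refine h.congr_fun (fun t _ => ?_) measurableSet_Ioi
  simp [mul_comm]

theorem integral_pow_mul_exp_neg (n : ℕ) :
    ∫ t in Ioi (0 : ℝ), t ^ n * Real.exp (-t) = n.factorial := by
  rw [← Real.Gamma_nat_eq_factorial, Real.Gamma_eq_integral (by positivity)]
  refine setIntegral_congr_fun measurableSet_Ioi fun t _ => ?_
  simp [mul_comm]

/-- Strictness makes the distribution function positive for `t > 0`, as the expansion by `e2`
requires. -/
theorem erlangTail_lt_one {n : ℕ} {t : ℝ} (ht : 0 < t) :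
    erlangTail (n + 1) t < 1 := by
  have hanti : StrictAntiOn (erlangTail (n + 1)) (Ici 0) := by
    refine strictAntiOn_of_deriv_neg (convex_Ici 0) (continuous_erlangTail _).continuousOn ?_
    intro s hs
    rw [interior_Ici] at hs
    have hs' : 0 < s := hs
    rw [(hasDerivAt_erlangTail n s).deriv]
    exact neg_neg_of_pos (by positivity)
  simpa [erlangTail_zero] using hanti self_mem_Ici ht.le ht

end Erlang

/-! ### Logarithmic integrals and the closed form `C1` -/

section LogIntegral

open Filter Topology Set

theorem upperGamma_neg_natCast (l : ℕ) {w : ℝ} (hw : 0 < w) :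
    upperGamma (-(l : ℝ)) w = ∫ t in Ioi w, (t ^ (l + 1))⁻¹ * Real.exp (-t) := by
  refine setIntegral_congr_fun measurableSet_Ioi fun t ht => ?_
  have ht' : 0 < t := hw.trans ht
  rw [show -(l : ℝ) - 1 = -((l + 1 : ℕ) : ℝ) by push_cast; ring, Real.rpow_neg ht'.le,
    Real.rpow_natCast]

theorem integrableOn_inv_pow_mul_exp_neg (l : ℕ) {w : ℝ} (hw : 0 < w) :
    IntegrableOn (fun t : ℝ => (t ^ l)⁻¹ * Real.exp (-t)) (Ioi w) := by
  have h : IntegrableOn (fun t : ℝ => (w ^ l)⁻¹ * Real.exp (-t)) (Ioi w) :=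
    (integrableOn_exp_neg_Ioi w).const_mul _
  refine h.mono' (by fun_prop) ?_
  filter_upwards [ae_restrict_mem measurableSet_Ioi] with t ht
  have ht' : w < t := ht
  have ht0 : 0 < t := hw.trans ht'
  rw [Real.norm_of_nonneg (by positivity)]
  gcongr

/-- The recurrence for the upper incomplete Gamma function at nonpositive integers. -/
theorem upperGamma_recurrence (l : ℕ) {w : ℝ} (hw : 0 < w) :
    upperGamma (-(l : ℝ)) w =
      (w ^ (l + 1))⁻¹ * Real.exp (-w) - ((l : ℝ) + 1) * upperGamma (-((l + 1 : ℕ) : ℝ)) w := by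
  rw [upperGamma_neg_natCast l hw, upperGamma_neg_natCast (l + 1) hw]
  have hd : ∀ t ∈ Ici w, HasDerivAt (fun t : ℝ => -((t ^ (l + 1))⁻¹ * Real.exp (-t)))
      (((l : ℝ) + 1) * ((t ^ (l + 1 + 1))⁻¹ * Real.exp (-t)) +
        (t ^ (l + 1))⁻¹ * Real.exp (-t)) t := by
    intro t ht
    have ht0 : t ≠ 0 := (hw.trans_le ht).ne'
    have h1 := (hasDerivAt_pow (l + 1) t).fun_inv (pow_ne_zero _ ht0)
    have h2 : HasDerivAt (fun t : ℝ => Real.exp (-t)) (-Real.exp (-t)) t := by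
      simpa using (hasDerivAt_neg t).exp
    refine (h1.mul h2).neg.congr_deriv ?_
    simp only [Nat.add_sub_cancel]
    push_cast
    field_simp
    ring
  have hi1 := (integrableOn_inv_pow_mul_exp_neg (l + 1 + 1) hw).const_mul ((l : ℝ) + 1)
  have hi2 := integrableOn_inv_pow_mul_exp_neg (l + 1) hw
  have hlim : Tendsto (fun t : ℝ => -((t ^ (l + 1))⁻¹ * Real.exp (-t))) atTop (𝓝 0) := by
    have h1 : Tendsto (fun t : ℝ => (t ^ (l + 1))⁻¹) atTop (𝓝 0) :=
      tendsto_inv_atTop_zero.comp (tendsto_pow_atTop (by omega))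
    have h2 : Tendsto (fun t : ℝ => Real.exp (-t)) atTop (𝓝 0) := Real.tendsto_exp_neg_atTop_nhds_zero
    simpa using (h1.mul h2).neg
  have := integral_Ioi_of_hasDerivAt_of_tendsto' hd (hi1.add hi2) hlim
  rw [integral_add hi1 hi2, integral_const_mul] at this
  linarith

theorem integrableOn_pow_mul_exp_neg_div (n : ℕ) {w : ℝ} (hw : 0 < w) :
    IntegrableOn (fun t : ℝ => t ^ n * Real.exp (-t) / (t + w)) (Ioi 0) := by
  have h := (integrableOn_pow_mul_exp_neg n).div_const w
  refine h.mono' (Measurable.aestronglyMeasurable (by fun_prop)) ?_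
  filter_upwards [ae_restrict_mem measurableSet_Ioi] with t ht
  have ht0 : 0 < t := ht
  rw [Real.norm_of_nonneg (by positivity)]
  gcongr
  linarith

/-- The case `n = 0` is the translation by `w`. Then `t ^ (n + 1) / (t + w) = t ^ n - w * t ^ n / (t
+ w)` reproduces the recurrence of the incomplete Gamma function. -/
theorem integral_pow_mul_exp_neg_div (n : ℕ) {w : ℝ} (hw : 0 < w) :
    ∫ t in Ioi (0 : ℝ), t ^ n * Real.exp (-t) / (t + w) =
      n.factorial * (w ^ n * upperGamma (-(n : ℝ)) w * Real.exp w) := by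
  induction n with
  | zero =>
    rw [upperGamma_neg_natCast 0 hw]
    have hpre : (fun t : ℝ => t + w) ⁻¹' Ioi w = Ioi 0 := by
      ext t
      simp
    have := (measurePreserving_add_right volume w).setIntegral_preimage_emb
      (measurableEmbedding_addRight w) (fun t : ℝ => (t ^ (0 + 1))⁻¹ * Real.exp (-t)) (Ioi w)
    rw [hpre] at this
    rw [← this, pow_zero, one_mul, Nat.factorial_zero, Nat.cast_one, one_mul, ← integral_mul_const]
    refine setIntegral_congr_fun measurableSet_Ioi fun t _ => ?_
    simp only [zero_add, pow_one, pow_zero, one_mul]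
    rw [mul_assoc, ← Real.exp_add]
    ring_nf
  | succ n ih =>
    have hsplit : ∫ t in Ioi (0 : ℝ), t ^ (n + 1) * Real.exp (-t) / (t + w) =
        (∫ t in Ioi (0 : ℝ), t ^ n * Real.exp (-t)) -
          w * ∫ t in Ioi (0 : ℝ), t ^ n * Real.exp (-t) / (t + w) := by
      rw [← integral_const_mul, ← integral_sub (integrableOn_pow_mul_exp_neg n)
        ((integrableOn_pow_mul_exp_neg_div n hw).const_mul w)]
      refine setIntegral_congr_fun measurableSet_Ioi fun t ht => ?_
      have ht0 : 0 < t := ht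
      have : t + w ≠ 0 := by positivity
      field_simp
      ring
    rw [hsplit, ih, integral_pow_mul_exp_neg, upperGamma_recurrence n hw]
    have hee : Real.exp (-w) * Real.exp w = 1 := by rw [← Real.exp_add]; simp
    have hww : w ^ (n + 1) * (w ^ (n + 1))⁻¹ = 1 := mul_inv_cancel₀ (by positivity)
    rw [Nat.factorial_succ]
    push_cast
    linear_combination (-(n.factorial : ℝ) * (w ^ (n + 1) * (w ^ (n + 1))⁻¹)) * hee -
      (n.factorial : ℝ) * hww

theorem log_one_add_div_nonneg {t w : ℝ} (ht : 0 ≤ t) (hw : 0 < w) : 0 ≤ Real.log (1 + t / w) :=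
  Real.log_nonneg (by have : 0 ≤ t / w := by positivity
                      linarith)

theorem log_one_add_div_le {t w : ℝ} (ht : 0 ≤ t) (hw : 0 < w) : Real.log (1 + t / w) ≤ t / w := by
  have h : 0 ≤ t / w := by positivity
  have := Real.log_le_sub_one_of_pos (show 0 < 1 + t / w by linarith)
  linarith

theorem integrableOn_log_mul_pow_mul_exp_neg (n : ℕ) {w : ℝ} (hw : 0 < w) :
    IntegrableOn (fun t : ℝ => Real.log (1 + t / w) * (t ^ n * Real.exp (-t))) (Ioi 0) := by
  have h := (integrableOn_pow_mul_exp_neg (n + 1)).div_const w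
  refine h.mono' (Measurable.aestronglyMeasurable (by fun_prop)) ?_
  filter_upwards [ae_restrict_mem measurableSet_Ioi] with t ht
  have ht0 : 0 < t := ht
  have h0 := log_one_add_div_nonneg ht0.le hw
  rw [Real.norm_of_nonneg (by positivity)]
  calc _ ≤ t / w * (t ^ n * Real.exp (-t)) := by
        gcongr
        exact log_one_add_div_le ht0.le hw
    _ = _ := by rw [pow_succ]; ring

/-- Integration by parts against `erlangTail (n + 1)`, whose derivative is minus the normalized
density. The logarithm becomes `1 / (t + w)`, and each term of the Erlang sum contributes one
incomplete Gamma value. -/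
theorem integral_log_mul_pow_mul_exp_neg (n : ℕ) {w : ℝ} (hw : 0 < w) :
    ∫ t in Ioi (0 : ℝ), Real.log (1 + t / w) * (t ^ n * Real.exp (-t)) =
      n.factorial * ∑ l ∈ Finset.range (n + 1), w ^ l * upperGamma (-(l : ℝ)) w * Real.exp w := by
  have hf : (n.factorial : ℝ) ≠ 0 := by positivity
  have hd : ∀ t ∈ Ici (0 : ℝ), HasDerivAt (fun t => -(Real.log (1 + t / w) * erlangTail (n + 1) t))
      (Real.log (1 + t / w) * (t ^ n * Real.exp (-t)) / (n.factorial : ℝ) -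
        erlangTail (n + 1) t / (t + w)) t := by
    intro t ht
    have ht0 : 0 ≤ t := ht
    have hpos : 0 < 1 + t / w := by positivity
    have h1 : HasDerivAt (fun t => 1 + t / w) (1 / w) t :=
      ((hasDerivAt_id t).div_const w).const_add 1
    refine ((h1.log hpos.ne').mul (hasDerivAt_erlangTail n t)).neg.congr_deriv ?_
    have : t + w ≠ 0 := by positivity
    field_simp
    ring
  have htail : (fun t : ℝ => erlangTail (n + 1) t / (t + w)) = fun t =>
      ∑ l ∈ Finset.range (n + 1), (1 / (l.factorial : ℝ)) * (t ^ l * Real.exp (-t) / (t + w)) := by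
    funext t
    rw [erlangTail, Finset.mul_sum, Finset.sum_div]
    exact Finset.sum_congr rfl fun l _ => by ring
  have hterm : ∀ l ∈ Finset.range (n + 1), IntegrableOn
      (fun t : ℝ => (1 / (l.factorial : ℝ)) * (t ^ l * Real.exp (-t) / (t + w))) (Ioi 0) :=
    fun l _ => (integrableOn_pow_mul_exp_neg_div l hw).const_mul _
  have hi1 := (integrableOn_log_mul_pow_mul_exp_neg n hw).div_const (n.factorial : ℝ)
  have hi2 : IntegrableOn (fun t : ℝ => erlangTail (n + 1) t / (t + w)) (Ioi 0) := by
    rw [htail]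
    exact integrable_finsetSum _ hterm
  -- The boundary term at infinity is dominated by `t / w` times the exponentially small tail; the
  -- one at `0` vanishes because `log 1 = 0`.
  have hlim : Tendsto (fun t => -(Real.log (1 + t / w) * erlangTail (n + 1) t)) atTop (𝓝 0) := by
    rw [← neg_zero]
    refine Tendsto.neg (squeeze_zero' (g := fun t => (t ^ 1 * erlangTail (n + 1) t) / w) ?_ ?_ ?_)
    · filter_upwards [eventually_ge_atTop 0] with t ht
      exact mul_nonneg (log_one_add_div_nonneg ht hw) (erlangTail_nonneg _ ht)
    · filter_upwards [eventually_ge_atTop 0] with t ht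
      calc _ ≤ t / w * erlangTail (n + 1) t :=
            mul_le_mul_of_nonneg_right (log_one_add_div_le ht hw) (erlangTail_nonneg _ ht)
        _ = _ := by ring
    · simpa using (tendsto_pow_mul_erlangTail (n + 1) 1).div_const w
  have := integral_Ioi_of_hasDerivAt_of_tendsto' hd (hi1.sub hi2) hlim
  rw [integral_sub hi1 hi2, integral_div, htail, integral_finsetSum _ hterm] at this
  simp only [zero_div, add_zero, Real.log_one, zero_mul, neg_zero, sub_zero] at this
  rw [sub_eq_zero, div_eq_iff hf] at this
  rw [this, mul_comm]
  congr 1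
  refine Finset.sum_congr rfl fun l _ => ?_
  have hl : (l.factorial : ℝ) ≠ 0 := by positivity
  rw [integral_const_mul, integral_pow_mul_exp_neg_div l hw]
  field_simp

theorem log_comp_mul_eq (n : ℕ) {a y : ℝ} (ha : 0 < a) (t : ℝ) :
    Real.log (1 + t / y) * (t ^ n * Real.exp (-(a * t))) =
      (a ^ n)⁻¹ * (Real.log (1 + a * t / (a * y)) * ((a * t) ^ n * Real.exp (-(a * t)))) := by
  rw [mul_div_mul_left _ _ ha.ne', mul_pow]
  have : a ^ n ≠ 0 := by positivity
  field_simp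

theorem integrableOn_log_mul_pow_mul_exp_neg_mul (n : ℕ) {a y : ℝ} (ha : 0 < a) (hy : 0 < y) :
    IntegrableOn (fun t : ℝ => Real.log (1 + t / y) * (t ^ n * Real.exp (-(a * t)))) (Ioi 0) := by
  simp only [log_comp_mul_eq n ha]
  refine Integrable.const_mul ?_ _
  have h := integrableOn_log_mul_pow_mul_exp_neg n (mul_pos ha hy)
  rw [← mul_zero a] at h
  exact (integrableOn_Ioi_comp_mul_left_iff
    (fun t : ℝ => Real.log (1 + t / (a * y)) * (t ^ n * Real.exp (-t))) 0 ha).mpr h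

theorem integral_log_mul_pow_mul_exp_neg_mul (n : ℕ) {a y : ℝ} (ha : 0 < a) (hy : 0 < y) :
    ∫ t in Ioi (0 : ℝ), Real.log (1 + t / y) * (t ^ n * Real.exp (-(a * t))) =
      (n.factorial : ℝ) / a ^ (n + 1) *
        ∑ l ∈ Finset.range (n + 1), (a * y) ^ l * upperGamma (-(l : ℝ)) (a * y) * Real.exp (a * y) := by
  simp only [log_comp_mul_eq n ha]
  rw [integral_const_mul, integral_comp_mul_left_Ioi
    (fun t : ℝ => Real.log (1 + t / (a * y)) * (t ^ n * Real.exp (-t))) 0 ha, mul_zero,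
    integral_log_mul_pow_mul_exp_neg n (mul_pos ha hy), smul_eq_mul, pow_succ, ← mul_assoc,
    ← mul_assoc]
  congr 1
  field_simp

/-- The expansion of the density of the maximum of `z` Gamma variables with integer shape. -/
theorem log_mul_maximum_density_eq (n z : ℕ) (y t : ℝ) :
    Real.log (1 + t / y) * ((1 - erlangTail (n + 1) t) ^ z * (t ^ n * Real.exp (-t))) =
      ∑ k ∈ Finset.range (z + 1), (-1) ^ k * (z.choose k : ℝ) *
        ∑ i ∈ Finset.range (k * n + 1), bCoeff (n + 1) k i *
          (Real.log (1 + t / y) * (t ^ (n + i) * Real.exp (-(((k : ℝ) + 1) * t)))) := by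
  have hb : ∀ k : ℕ, erlangTail (n + 1) t ^ k =
      Real.exp (-(k * t)) * ∑ i ∈ Finset.range (k * n + 1), bCoeff (n + 1) k i * t ^ i := by
    intro k
    have := pow_sum_eq_sum_bCoeff (n + 1) k (by omega) t
    rw [Nat.add_sub_cancel] at this
    rw [erlangTail, mul_pow, this, ← Real.exp_nat_mul]
    congr 2
    ring
  rw [sub_eq_neg_add, add_pow]
  simp only [one_pow, mul_one, Finset.sum_mul, Finset.mul_sum]
  refine Finset.sum_congr rfl fun k _ => ?_
  rw [neg_pow, hb, Finset.mul_sum, Finset.mul_sum, Finset.sum_mul, Finset.sum_mul, Finset.mul_sum]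
  refine Finset.sum_congr rfl fun i _ => ?_
  rw [pow_add, show -(((k : ℝ) + 1) * t) = -(k * t) + -t by ring, Real.exp_add]
  ring

theorem integrableOn_log_mul_maximum_density (n z : ℕ) {y : ℝ} (hy : 0 < y) :
    IntegrableOn (fun t => Real.log (1 + t / y) *
      ((1 - erlangTail (n + 1) t) ^ z * (t ^ n * Real.exp (-t)))) (Ioi 0) := by
  simp only [log_mul_maximum_density_eq]
  refine integrable_finsetSum _ fun k _ => Integrable.const_mul (integrable_finsetSum _ fun i _ =>
    Integrable.const_mul ?_ _) _
  exact integrableOn_log_mul_pow_mul_exp_neg_mul (n + i) (by positivity) hy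

/-- `C₁` is the expected rate of the strongest of `z` channels. -/
theorem C1_eq_integral (n z : ℕ) {y : ℝ} (hy : 0 < y) :
    C1 (n + 1) y (z + 1) = (((z + 1 : ℕ) : ℝ) / ((n.factorial : ℝ) * Real.log 2)) *
      ∫ t in Ioi (0 : ℝ), Real.log (1 + t / y) *
        ((1 - erlangTail (n + 1) t) ^ z * (t ^ n * Real.exp (-t))) := by
  have hint : ∀ k i : ℕ, IntegrableOn (fun t : ℝ => bCoeff (n + 1) k i * (Real.log (1 + t / y) *
      (t ^ (n + i) * Real.exp (-(((k : ℝ) + 1) * t))))) (Ioi 0) := fun k i =>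
    (integrableOn_log_mul_pow_mul_exp_neg_mul (n + i) (by positivity) hy).const_mul _
  simp only [log_mul_maximum_density_eq]
  rw [C1, integral_finsetSum _ fun k _ => Integrable.const_mul (integrable_finsetSum _ fun i _ =>
    hint k i) _]
  simp only [Nat.add_sub_cancel]
  congr 1
  refine Finset.sum_congr rfl fun k _ => ?_
  rw [integral_const_mul, integral_finsetSum _ fun i _ => hint k i]
  congr 1
  refine Finset.sum_congr rfl fun i _ => ?_
  rw [integral_const_mul, integral_log_mul_pow_mul_exp_neg_mul (n + i) (by positivity) hy,
    show n + 1 + i - 1 = n + i by omega, show n + 1 + i = n + i + 1 by omega]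
  ring

end LogIntegral

/-! ### The CQI has a Gamma law, by characteristic functions -/

section GammaLaw

open Filter Topology Set
open scoped ENNReal NNReal

theorem integrableOn_pow_mul_exp_neg_mul (n : ℕ) {r : ℝ} (hr : 0 < r) :
    IntegrableOn (fun t : ℝ => t ^ n * Real.exp (-(r * t))) (Ioi 0) := by
  have h := integrableOn_pow_mul_exp_neg n
  rw [← mul_zero r] at h
  have h2 := ((integrableOn_Ioi_comp_mul_left_iff
    (fun t : ℝ => t ^ n * Real.exp (-t)) 0 hr).mpr h).const_mul (r ^ n)⁻¹
  refine IntegrableOn.congr_fun h2 (fun t _ => ?_) measurableSet_Ioi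
  have : r ^ n ≠ 0 := by positivity
  simp only [mul_pow]
  field_simp

theorem integrableOn_pow_mul_cexp_neg_mul (n : ℕ) {z : ℂ} (hz : 0 < z.re) :
    IntegrableOn (fun t : ℝ => (t : ℂ) ^ n * Complex.exp (-(z * t))) (Ioi 0) := by
  refine (integrableOn_pow_mul_exp_neg_mul n hz).mono' (by fun_prop) ?_
  filter_upwards [ae_restrict_mem measurableSet_Ioi] with t ht
  have ht0 : 0 < t := ht
  rw [norm_mul, norm_pow, Complex.norm_real, Real.norm_of_nonneg ht0.le, Complex.norm_exp]
  simp

/-- Induction by parts, since a complex rate cannot be absorbed by a real change of variables. -/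
theorem integral_pow_mul_cexp_neg_mul (n : ℕ) {z : ℂ} (hz : 0 < z.re) :
    ∫ t in Ioi (0 : ℝ), (t : ℂ) ^ n * Complex.exp (-(z * t)) = n.factorial / z ^ (n + 1) := by
  have hz0 : z ≠ 0 := by
    rintro rfl
    simp at hz
  have hderiv : ∀ t : ℝ, HasDerivAt (fun t : ℝ => Complex.exp (-(z * t)))
      (-z * Complex.exp (-(z * t))) t := by
    intro t
    have h1 : HasDerivAt (fun t : ℝ => -(z * (t : ℂ))) (-z) t := by
      simpa using ((hasDerivAt_id t).ofReal_comp.const_mul z).fun_neg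
    simpa [mul_comm] using h1.cexp
  have hlim : ∀ n : ℕ, Tendsto (fun t : ℝ => -((t : ℂ) ^ n * Complex.exp (-(z * t)) / z)) atTop
      (𝓝 0) := by
    intro n
    have h : Tendsto (fun t : ℝ => t ^ n * Real.exp (-(z.re * t))) atTop (𝓝 0) := by
      have h1 := ((Real.tendsto_pow_mul_exp_neg_atTop_nhds_zero n).comp
        (tendsto_id.const_mul_atTop hz)).const_mul (z.re ^ n)⁻¹
      rw [mul_zero] at h1
      refine h1.congr fun t => ?_
      have : z.re ^ n ≠ 0 := by positivity
      simp only [Function.comp, id, mul_pow]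
      field_simp
    have h2 : Tendsto (fun t : ℝ => (t : ℂ) ^ n * Complex.exp (-(z * t))) atTop (𝓝 0) := by
      rw [tendsto_zero_iff_norm_tendsto_zero]
      refine h.congr' ?_
      filter_upwards [eventually_ge_atTop 0] with t ht
      rw [norm_mul, norm_pow, Complex.norm_real, Real.norm_of_nonneg ht, Complex.norm_exp]
      simp
    simpa using (h2.div_const z).neg
  induction n with
  | zero =>
    have hd : ∀ t ∈ Ici (0 : ℝ), HasDerivAt
        (fun t : ℝ => -((t : ℂ) ^ 0 * Complex.exp (-(z * t)) / z))
        ((t : ℂ) ^ 0 * Complex.exp (-(z * t))) t := by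
      intro t _
      simp only [pow_zero, one_mul]
      refine ((hderiv t).div_const z).neg.congr_deriv ?_
      field_simp
    have := integral_Ioi_of_hasDerivAt_of_tendsto' hd
      (integrableOn_pow_mul_cexp_neg_mul 0 hz) (hlim 0)
    rw [this]
    simp
  | succ n ih =>
    have hd : ∀ t ∈ Ici (0 : ℝ), HasDerivAt
        (fun t : ℝ => -((t : ℂ) ^ (n + 1) * Complex.exp (-(z * t)) / z))
        ((t : ℂ) ^ (n + 1) * Complex.exp (-(z * t)) -
          (((n : ℂ) + 1) / z) * ((t : ℂ) ^ n * Complex.exp (-(z * t)))) t := by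
      intro t _
      have hp : HasDerivAt (fun t : ℝ => (t : ℂ) ^ (n + 1)) (((n : ℂ) + 1) * (t : ℂ) ^ n) t := by
        simpa using (hasDerivAt_id t).ofReal_comp.fun_pow (n + 1)
      refine ((hp.mul (hderiv t)).div_const z).neg.congr_deriv ?_
      field_simp
      ring
    have hi1 := integrableOn_pow_mul_cexp_neg_mul (n + 1) hz
    have hi2 := (integrableOn_pow_mul_cexp_neg_mul n hz).const_mul (((n : ℂ) + 1) / z)
    have := integral_Ioi_of_hasDerivAt_of_tendsto' hd (hi1.sub hi2) (hlim (n + 1))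
    rw [integral_sub hi1 hi2, integral_const_mul, ih, sub_eq_iff_eq_add] at this
    rw [this, Nat.factorial_succ]
    push_cast
    simp
    field_simp
    ring

theorem gammaMeasure_natCast_succ (n : ℕ) (r : ℝ) :
    gammaMeasure ((n + 1 : ℕ) : ℝ) r = (volume.restrict (Ioi 0)).withDensity
      fun t => ENNReal.ofReal (r ^ (n + 1) / n.factorial * (t ^ n * Real.exp (-(r * t)))) := by
  rw [gammaMeasure, restrict_Ioi_eq_restrict_Ici, ← withDensity_indicator measurableSet_Ici]
  congr 1
  funext t
  rw [gammaPDF_eq, Set.indicator_apply]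
  simp only [mem_Ici]
  split_ifs with h
  · have h1 : Real.Gamma ((n + 1 : ℕ) : ℝ) = n.factorial := by
      rw [Nat.cast_succ, Real.Gamma_nat_eq_factorial]
    rw [h1, Real.rpow_natCast]
    congr 1
    rw [Nat.cast_succ, add_sub_cancel_right, Real.rpow_natCast, mul_assoc]
  · simp

theorem integral_gammaMeasure_natCast_succ {E : Type*} [NormedAddCommGroup E] [NormedSpace ℝ E]
    (n : ℕ) {r : ℝ} (hr : 0 < r) (f : ℝ → E) :
    ∫ t, f t ∂gammaMeasure ((n + 1 : ℕ) : ℝ) r =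
      ∫ t in Ioi (0 : ℝ), (r ^ (n + 1) / n.factorial * (t ^ n * Real.exp (-(r * t)))) • f t := by
  rw [gammaMeasure_natCast_succ n r, integral_withDensity_eq_integral_toReal_smul (by fun_prop)
    (Eventually.of_forall fun _ => ENNReal.ofReal_lt_top)]
  refine setIntegral_congr_fun measurableSet_Ioi fun t ht => ?_
  have ht0 : 0 < t := ht
  rw [ENNReal.toReal_ofReal (by positivity)]

theorem charFun_gammaMeasure_natCast_succ (n : ℕ) {r : ℝ} (hr : 0 < r) (s : ℝ) :
    charFun (gammaMeasure ((n + 1 : ℕ) : ℝ) r) s =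
      (1 / (1 - s / r * Complex.I)) ^ (n + 1) := by
  rw [charFun_apply_real, integral_gammaMeasure_natCast_succ n hr]
  have hz : 0 < ((r : ℂ) - s * Complex.I).re := by simpa using hr
  have hz0 : (r : ℂ) - s * Complex.I ≠ 0 := fun h => by simp [h] at hz
  have hr0 : (r : ℂ) ≠ 0 := by exact_mod_cast hr.ne'
  have hn : (n.factorial : ℂ) ≠ 0 := by exact_mod_cast n.factorial_ne_zero
  calc _ = ∫ t in Ioi (0 : ℝ), ((r : ℂ) ^ (n + 1) / n.factorial) *
          ((t : ℂ) ^ n * Complex.exp (-(((r : ℂ) - s * Complex.I) * t))) := by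
        refine setIntegral_congr_fun measurableSet_Ioi fun t _ => ?_
        simp only [Complex.real_smul]
        push_cast
        rw [mul_assoc, mul_assoc, ← Complex.exp_add]
        ring_nf
    _ = _ := by
        rw [integral_const_mul, integral_pow_mul_cexp_neg_mul n hz]
        rw [show (1 : ℂ) - s / r * Complex.I = (r - s * Complex.I) / r by field_simp, one_div_div,
          div_pow]
        field_simp

/-- Stated for the square because a complex Gaussian has two independent real components; squaring
also removes the complex square root in the Gaussian integral. -/
theorem integral_cexp_sq_gaussianReal {v : ℝ} (hv : 0 < v) (s : ℝ) :
    (∫ x, Complex.exp (((s * x ^ 2 : ℝ) : ℂ) * Complex.I) ∂gaussianReal 0 (v / 2).toNNReal) ^ 2 =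
      1 / (1 - s * v * Complex.I) := by
  have hv2 : (v / 2).toNNReal ≠ 0 := by simpa using hv
  have hv0 : (v : ℂ) ≠ 0 := by exact_mod_cast hv.ne'
  rw [integral_gaussianReal_eq_integral_smul hv2]
  have hb : 0 < ((1 : ℂ) / v - s * Complex.I).re := by
    rw [← Complex.ofReal_one, ← Complex.ofReal_div]
    simpa using hv
  have hb0 : (1 : ℂ) / v - s * Complex.I ≠ 0 := fun h => by rw [h] at hb; simp at hb
  have hpi : (Real.pi : ℂ) ≠ 0 := by exact_mod_cast Real.pi_ne_zero
  have hint : ∫ x : ℝ, gaussianPDFReal 0 (v / 2).toNNReal x •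
        Complex.exp (((s * x ^ 2 : ℝ) : ℂ) * Complex.I) =
      ((√(Real.pi * v))⁻¹ : ℝ) * ((Real.pi : ℂ) / ((1 : ℂ) / v - s * Complex.I)) ^ (1 / 2 : ℂ) := by
    rw [← integral_gaussian_complex hb, ← integral_const_mul]
    refine integral_congr_ae (Eventually.of_forall fun x => ?_)
    simp only [gaussianPDFReal, Complex.real_smul, Real.coe_toNNReal _ (half_pos hv).le]
    rw [show 2 * Real.pi * (v / 2) = Real.pi * v by ring]
    push_cast
    rw [mul_assoc, ← Complex.exp_add]
    congr 2
    field_simp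
    ring
  rw [hint, mul_pow, ← Complex.cpow_nat_mul, ← Complex.ofReal_pow, inv_pow,
    Real.sq_sqrt (by positivity)]
  simp only [Nat.cast_ofNat, mul_one_div_cancel (two_ne_zero' ℂ), Complex.cpow_one]
  push_cast
  rw [show (1 : ℂ) - s * v * Complex.I = v * (1 / v - s * Complex.I) by field_simp]
  field_simp

theorem integral_cexp_norm_sq_complexGaussian {v : ℝ} (hv : 0 < v) (s : ℝ) :
    ∫ h, Complex.exp (((s * ‖h‖ ^ 2 : ℝ) : ℂ) * Complex.I) ∂complexGaussian v =
      1 / (1 - s * v * Complex.I) := by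
  rw [complexGaussian, integral_map (by fun_prop) (by fun_prop), ← integral_cexp_sq_gaussianReal hv,
    sq, ← integral_prod_mul]
  refine integral_congr_ae (Eventually.of_forall fun p => ?_)
  dsimp only
  rw [← Complex.exp_add, ← Complex.normSq_eq_norm_sq, Complex.normSq_add_mul_I]
  push_cast
  ring_nf

instance (v : ℝ) : IsProbabilityMeasure (complexGaussian v) := by
  unfold complexGaussian
  exact Measure.isProbabilityMeasure_map (by fun_prop)

/-- A weighted sum of the squared moduli of i.i.d. complex Gaussians has a Gamma distribution. -/
theorem map_sum_norm_sq_complexGaussian (n : ℕ) {v r : ℝ} (hv : 0 < v) (hr : 0 < r) :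
    (Measure.pi fun _ : Fin (n + 1) => complexGaussian v).map
        (fun h => (1 / (r * v)) * ∑ i, ‖h i‖ ^ 2) =
      gammaMeasure ((n + 1 : ℕ) : ℝ) r := by
  have := isProbabilityMeasure_gammaMeasure (a := ((n + 1 : ℕ) : ℝ)) (by positivity) hr
  have hmeas : Measurable (fun h : Fin (n + 1) → ℂ => (1 / (r * v)) * ∑ i, ‖h i‖ ^ 2) := by
    fun_prop
  have := Measure.isProbabilityMeasure_map (μ := Measure.pi fun _ : Fin (n + 1) => complexGaussian v)
    hmeas.aemeasurable
  -- By independence the characteristic function is the `(n + 1)`-st power of that of one squared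
  -- modulus, an exponential variable.
  refine Measure.ext_of_charFun (funext fun s => ?_)
  rw [charFun_gammaMeasure_natCast_succ n hr, charFun_apply_real,
    integral_map hmeas.aemeasurable (by fun_prop)]
  calc _ = ∫ h : Fin (n + 1) → ℂ, ∏ i,
          Complex.exp (((s / (r * v) * ‖h i‖ ^ 2 : ℝ) : ℂ) * Complex.I)
            ∂(Measure.pi fun _ : Fin (n + 1) => complexGaussian v) := by
        refine integral_congr_ae (Eventually.of_forall fun h => ?_)
        dsimp only
        rw [← Complex.exp_sum, ← Finset.sum_mul, ← Complex.ofReal_sum, ← Finset.mul_sum]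
        push_cast
        congr 1
        ring
    _ = _ := by
        rw [integral_fintype_prod_eq_pow (fun h : ℂ =>
          Complex.exp (((s / (r * v) * ‖h‖ ^ 2 : ℝ) : ℂ) * Complex.I)),
          integral_cexp_norm_sq_complexGaussian hv, Fintype.card_fin]
        have hv0 : (v : ℂ) ≠ 0 := by exact_mod_cast hv.ne'
        have hr0 : (r : ℂ) ≠ 0 := by exact_mod_cast hr.ne'
        push_cast
        congr 3
        field_simp

end GammaLaw

/-! ### Feedback and scheduling events under product measures -/

section ProductMeasure

open Filter Topology Set
open scoped ENNReal NNReal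

theorem lintegral_pi_succAbove {E : Type*} [MeasurableSpace E] (ν : Measure E) [SigmaFinite ν]
    {n : ℕ} (r : Fin (n + 1)) {F : E × (Fin n → E) → ℝ≥0∞} (hF : Measurable F) :
    ∫⁻ y : Fin (n + 1) → E, F (y r, fun j => y (r.succAbove j)) ∂(Measure.pi fun _ => ν) =
      ∫⁻ t, ∫⁻ z : Fin n → E, F (t, z) ∂(Measure.pi fun _ => ν) ∂ν := by
  rw [← lintegral_prod _ hF.aemeasurable,
    ← (measurePreserving_piFinSuccAbove (fun _ : Fin (n + 1) => ν) r).lintegral_comp hF]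
  rfl

theorem indicator_eq_indicator_of_mem_iff {α β M : Type*} [Zero M] {s : Set α} {t : Set β}
    {f : α → M} {g : β → M} {x : α} {y : β} (h : x ∈ s ↔ y ∈ t) (hfg : f x = g y) :
    s.indicator f x = t.indicator g y := by
  by_cases hx : x ∈ s
  · rw [Set.indicator_of_mem hx, Set.indicator_of_mem (h.mp hx), hfg]
  · rw [Set.indicator_of_notMem hx, Set.indicator_of_notMem fun hy => hx (h.mpr hy)]

theorem indicator_eq_mul_indicator_one {α β : Type*} {s : Set α} {t : Set β}
    {f : α → ℝ≥0∞} {c : ℝ≥0∞} {x : α} {y : β} (h : x ∈ s ↔ y ∈ t) (hfg : f x = c) :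
    s.indicator f x = c * t.indicator 1 y := by
  by_cases hx : x ∈ s
  · rw [Set.indicator_of_mem hx, Set.indicator_of_mem (h.mp hx), hfg, Pi.one_apply, mul_one]
  · rw [Set.indicator_of_notMem hx, Set.indicator_of_notMem fun hy => hx (h.mpr hy), mul_zero]

/-- The event splits, according to the set `T` of coordinates exceeding `t`, into disjoint boxes
whose probability depends only on the cardinality of `T`. -/
theorem pi_card_exceedance_lt (μ : Measure ℝ) [IsProbabilityMeasure μ] (n b : ℕ) (t : ℝ) :
    (Measure.pi fun _ : Fin n => μ) {y | (Finset.univ.filter fun s => t < y s).card < b} =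
      ENNReal.ofReal (exceedanceProb n b (μ.real (Iic t))) := by
  set u := μ.real (Iic t) with hu
  have hIoi : μ.real (Ioi t) = 1 - u := by
    rw [← compl_Iic, probReal_compl_eq_one_sub measurableSet_Iic]
  set A : Finset (Fin n) → Set (Fin n → ℝ) := fun T =>
    Set.pi univ fun s => if s ∈ T then Ioi t else Iic t with hA
  have hmem : ∀ T y, y ∈ A T ↔ (Finset.univ.filter fun s => t < y s) = T := by
    intro T y
    simp only [hA, Set.mem_pi, mem_univ, true_implies, Finset.ext_iff, Finset.mem_filter,
      Finset.mem_univ, true_and]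
    refine forall_congr' fun s => ?_
    split_ifs with h <;> simp [h]
  have hset : {y : Fin n → ℝ | (Finset.univ.filter fun s => t < y s).card < b} =
      ⋃ T ∈ (Finset.univ.filter fun T : Finset (Fin n) => T.card < b), A T := by
    ext y
    simp [hmem]
  have hmeas : ∀ T, MeasurableSet (A T) := fun T =>
    MeasurableSet.univ_pi fun s => by split_ifs <;> measurability
  have hprob : ∀ T, (Measure.pi fun _ : Fin n => μ) (A T) =
      ENNReal.ofReal (u ^ (n - T.card) * (1 - u) ^ T.card) := by
    intro T
    rw [← ofReal_measureReal, measureReal_def, Measure.pi_pi, ENNReal.toReal_prod]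
    congr 1
    have : ∀ s, (μ (if s ∈ T then Ioi t else Iic t)).toReal = if s ∈ T then 1 - u else u := by
      intro s
      rw [← measureReal_def]
      split_ifs
      · exact hIoi
      · rfl
    simp only [this]
    rw [Finset.prod_ite, Finset.prod_const, Finset.prod_const, mul_comm]
    have h1 : (Finset.univ.filter fun s => s ∈ T) = T := by ext; simp
    have h2 : (Finset.univ.filter fun s => s ∉ T) = Tᶜ := by ext; simp
    rw [h1, h2, Finset.card_compl, Fintype.card_fin]
  have hu1 : u ≤ 1 := measureReal_le_one
  have hu0 : 0 ≤ u := measureReal_nonneg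
  rw [hset, measure_biUnion_finset]
  · simp only [hprob]
    rw [← ENNReal.ofReal_sum_of_nonneg fun T _ => by
      have := sub_nonneg.mpr hu1
      positivity]
    congr 1
    have hsum := Finset.sum_powerset_apply_card (x := (Finset.univ : Finset (Fin n)))
      (fun l => if l < b then u ^ (n - l) * (1 - u) ^ l else 0)
    rw [Finset.sum_filter, ← Finset.powerset_univ, hsum, exceedanceProb]
    simp only [Finset.card_univ, Fintype.card_fin, nsmul_eq_mul, mul_ite, mul_zero]
    rw [← Finset.sum_filter]
    refine Finset.sum_subset (fun l hl => by simp at hl ⊢; exact hl.2) fun l hl hl' => ?_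
    simp only [Finset.mem_filter, Finset.mem_range] at hl hl'
    rw [Nat.choose_eq_zero_of_lt (by omega)]
    simp
  · intro T _ T' _ hne
    refine Set.disjoint_left.mpr fun y hy hy' => hne ?_
    rw [← (hmem T y).mp hy, (hmem T' y).mp hy']
  · exact fun T _ => hmeas T

/-- The event that block `r` is among the best `b` blocks when there are no ties. -/
def bestBlocks {a : ℕ} (b : ℕ) (r : Fin a) : Set (Fin a → ℝ) :=
  {y | (Finset.univ.filter fun s => y r < y s).card < b}

theorem measurableSet_card_filter_lt {α : Type*} [MeasurableSpace α] {n : ℕ} (b : ℕ)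
    {f : Fin n → α → Prop} [∀ s x, Decidable (f s x)] (hf : ∀ s, MeasurableSet {x | f s x}) :
    MeasurableSet {x | (Finset.univ.filter fun s => f s x).card < b} := by
  simp only [Finset.card_filter]
  refine measurableSet_lt (Finset.measurable_fun_sum _ fun s _ => ?_) measurable_const
  exact Measurable.ite (hf s) measurable_const measurable_const

theorem measurableSet_bestBlocks {a : ℕ} (b : ℕ) (r : Fin a) : MeasurableSet (bestBlocks b r) :=
  measurableSet_card_filter_lt b fun s =>
    measurableSet_lt (measurable_pi_apply r) (measurable_pi_apply s)

/-- Condition on coordinate `r`: it never exceeds itself, so only the other `n` coordinates count.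
-/
theorem lintegral_indicator_bestBlocks (μ : Measure ℝ) [IsProbabilityMeasure μ] (n b : ℕ)
    (r : Fin (n + 1)) {g : ℝ → ℝ≥0∞} (hg : Measurable g) :
    ∫⁻ y, (bestBlocks b r).indicator (fun y => g (y r)) y
        ∂(Measure.pi fun _ : Fin (n + 1) => μ) =
      ∫⁻ t, g t * ENNReal.ofReal (exceedanceProb n b (μ.real (Iic t))) ∂μ := by
  set S : Set (ℝ × (Fin n → ℝ)) := {p | (Finset.univ.filter fun s => p.1 < p.2 s).card < b} with hS
  have hSm : MeasurableSet S := measurableSet_card_filter_lt b fun s =>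
    measurableSet_lt measurable_fst ((measurable_pi_apply s).comp measurable_snd)
  have h := lintegral_pi_succAbove μ r (F := S.indicator fun p => g p.1)
    ((hg.comp measurable_fst).indicator hSm)
  have hl : ∀ y : Fin (n + 1) → ℝ, (bestBlocks b r).indicator (fun y => g (y r)) y =
      S.indicator (fun p => g p.1) (y r, fun j => y (r.succAbove j)) := by
    intro y
    have : y ∈ bestBlocks b r ↔ (y r, fun j => y (r.succAbove j)) ∈ S := by
      simp only [bestBlocks, hS, mem_ofPred_eq, Finset.card_filter]
      rw [Fin.sum_univ_succAbove _ r]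
      simp
    exact indicator_eq_indicator_of_mem_iff this rfl
  simp only [hl]
  rw [h]
  refine lintegral_congr fun t => ?_
  rw [← pi_card_exceedance_lt, ← lintegral_indicator_one (measurableSet_card_filter_lt b fun s =>
    measurableSet_lt measurable_const (measurable_pi_apply s)), ← lintegral_const_mul _
      (measurable_one.indicator (measurableSet_card_filter_lt b fun s =>
        measurableSet_lt measurable_const (measurable_pi_apply s)))]
  exact lintegral_congr fun z => indicator_eq_mul_indicator_one (by simp [hS]) rfl

/-- The event that user `k` is scheduled on block `r` when there are no ties. -/
def scheduled {N a : ℕ} (b : ℕ) (r : Fin a) (k : Fin N) : Set (Fin N → Fin a → ℝ) :=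
  {x | x k ∈ bestBlocks b r ∧ ∀ j, j ≠ k → x j ∉ bestBlocks b r ∨ x j r ≤ x k r}

theorem measurableSet_scheduled {N a : ℕ} (b : ℕ) (r : Fin a) (k : Fin N) :
    MeasurableSet (scheduled b r k) := by
  have h : ∀ j : Fin N, MeasurableSet {x : Fin N → Fin a → ℝ | x j ∈ bestBlocks b r} := fun j =>
    (measurable_pi_apply j) (measurableSet_bestBlocks b r)
  have heq : scheduled b r k = {x : Fin N → Fin a → ℝ | x k ∈ bestBlocks b r} ∩
      ⋂ j, ⋂ _ : j ≠ k, ({x | x j ∈ bestBlocks b r}ᶜ ∪ {x | x j r ≤ x k r}) := by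
    ext x
    simp [scheduled]
  rw [heq]
  refine (h k).inter (MeasurableSet.iInter fun j => MeasurableSet.iInter fun _ =>
    (h j).compl.union ?_)
  exact measurableSet_le (by fun_prop) (by fun_prop)

/-- Given the row of user `k`, the other `N` rows are independent and each must satisfy the same
condition at level `x k r`, whence the `N`-th power. -/
theorem lintegral_indicator_scheduled (μ : Measure ℝ) [IsProbabilityMeasure μ] (N n b : ℕ)
    (r : Fin (n + 1)) (k : Fin (N + 1)) {g : ℝ → ℝ≥0∞} (hg : Measurable g) :
    ∫⁻ x, (scheduled b r k).indicator (fun x => g (x k r)) x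
        ∂(Measure.pi fun _ : Fin (N + 1) => Measure.pi fun _ : Fin (n + 1) => μ) =
      ∫⁻ t, g t * (Measure.pi fun _ : Fin (n + 1) => μ) {y | y ∉ bestBlocks b r ∨ y r ≤ t} ^ N *
        ENNReal.ofReal (exceedanceProb n b (μ.real (Iic t))) ∂μ := by
  set ν := Measure.pi fun _ : Fin (n + 1) => μ with hν
  have hQ : ∀ t, MeasurableSet {y : Fin (n + 1) → ℝ | y ∉ bestBlocks b r ∨ y r ≤ t} := fun t =>
    (measurableSet_bestBlocks b r).compl.union
      (measurableSet_le (measurable_pi_apply r) measurable_const)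
  set S : Set ((Fin (n + 1) → ℝ) × (Fin N → Fin (n + 1) → ℝ)) :=
    {p | p.1 ∈ bestBlocks b r ∧ ∀ j, p.2 j ∉ bestBlocks b r ∨ p.2 j r ≤ p.1 r} with hS
  have hSm : MeasurableSet S := by
    have heq : S = (Prod.fst ⁻¹' bestBlocks b r) ∩
        ⋂ j, (((fun p : (Fin (n + 1) → ℝ) × (Fin N → Fin (n + 1) → ℝ) => p.2 j) ⁻¹'
          bestBlocks b r)ᶜ ∪ {p | p.2 j r ≤ p.1 r}) := by
      ext p
      simp [hS]
    rw [heq]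
    refine (measurable_fst (measurableSet_bestBlocks b r)).inter (MeasurableSet.iInter fun j =>
      MeasurableSet.union ?_ ?_)
    · exact (((measurable_pi_apply j).comp measurable_snd) (measurableSet_bestBlocks b r)).compl
    · exact measurableSet_le (by fun_prop) (by fun_prop)
  have h := lintegral_pi_succAbove ν k (F := S.indicator fun p => g (p.1 r))
    ((hg.comp (by fun_prop)).indicator hSm)
  have hl : ∀ x : Fin (N + 1) → Fin (n + 1) → ℝ,
      (scheduled b r k).indicator (fun x => g (x k r)) x =
        S.indicator (fun p => g (p.1 r)) (x k, fun j => x (k.succAbove j)) := by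
    intro x
    have : x ∈ scheduled b r k ↔ (x k, fun j => x (k.succAbove j)) ∈ S := by
      simp only [scheduled, hS, mem_ofPred_eq]
      rw [Fin.forall_iff_succAbove (P := fun j => j ≠ k → _) k]
      simp [Fin.succAbove_ne]
    exact indicator_eq_indicator_of_mem_iff this rfl
  have hmono : Measurable fun t => ν {y | y ∉ bestBlocks b r ∨ y r ≤ t} :=
    Monotone.measurable fun s t hst => measure_mono fun y hy => hy.imp id fun h => h.trans hst
  simp only [hl]
  rw [h, ← lintegral_indicator_bestBlocks μ n b r
    (g := fun t => g t * ν {y | y ∉ bestBlocks b r ∨ y r ≤ t} ^ N) (hg.mul (hmono.pow_const N))]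
  refine lintegral_congr fun e => ?_
  by_cases he : e ∈ bestBlocks b r
  · rw [Set.indicator_of_mem he]
    have hpi : {z : Fin N → Fin (n + 1) → ℝ | ∀ j, z j ∉ bestBlocks b r ∨ z j r ≤ e r} =
        Set.pi univ fun _ => {y | y ∉ bestBlocks b r ∨ y r ≤ e r} := by
      ext z
      simp
    have hm := MeasurableSet.univ_pi fun _ : Fin N => hQ (e r)
    have hval : (Measure.pi fun _ : Fin N => ν)
        (Set.pi univ fun _ => {y | y ∉ bestBlocks b r ∨ y r ≤ e r}) =
          ν {y | y ∉ bestBlocks b r ∨ y r ≤ e r} ^ N := by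
      rw [Measure.pi_pi]
      simp
    rw [← hval, ← lintegral_indicator_one hm, ← lintegral_const_mul _ (measurable_one.indicator hm)]
    refine lintegral_congr fun z => indicator_eq_mul_indicator_one ?_ rfl
    rw [← hpi]
    simp [hS, he]
  · rw [Set.indicator_of_notMem he]
    simp [hS, he]

end ProductMeasure

/-! ### Feedback probabilities for Gamma variables -/

section GammaCdf

open Filter Topology Set
open scoped ENNReal NNReal

theorem tendsto_erlangTail (x : ℕ) : Tendsto (erlangTail x) atTop (𝓝 0) := by
  simpa using tendsto_pow_mul_erlangTail x 0

theorem gammaMeasure_one_eq (n : ℕ) :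
    gammaMeasure ((n + 1 : ℕ) : ℝ) 1 = (volume.restrict (Ioi 0)).withDensity
      fun t => ENNReal.ofReal (t ^ n * Real.exp (-t) / n.factorial) := by
  rw [gammaMeasure_natCast_succ]
  congr 1
  funext t
  congr 1
  rw [one_mul, one_pow]
  ring

theorem lintegral_gammaMeasure_one (n : ℕ) {g : ℝ → ℝ≥0∞} (hg : Measurable g) :
    ∫⁻ t, g t ∂gammaMeasure ((n + 1 : ℕ) : ℝ) 1 =
      ∫⁻ t in Ioi 0, g t * ENNReal.ofReal (t ^ n * Real.exp (-t) / n.factorial) := by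
  rw [gammaMeasure_one_eq, lintegral_withDensity_eq_lintegral_mul _ (by fun_prop) hg]
  exact lintegral_congr fun t => mul_comm _ _

theorem setLIntegral_Ioi_gammaMeasure_one (n : ℕ) {t : ℝ} (ht : 0 ≤ t) {g : ℝ → ℝ≥0∞}
    (hg : Measurable g) :
    ∫⁻ s, (Ioi t).indicator g s ∂gammaMeasure ((n + 1 : ℕ) : ℝ) 1 =
      ∫⁻ s in Ioi t, g s * ENNReal.ofReal (s ^ n * Real.exp (-s) / n.factorial) := by
  rw [lintegral_gammaMeasure_one n (hg.indicator measurableSet_Ioi)]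
  rw [← lintegral_indicator measurableSet_Ioi, ← lintegral_indicator measurableSet_Ioi]
  refine lintegral_congr fun s => ?_
  by_cases h : s ∈ Ioi t
  · rw [Set.indicator_of_mem h, Set.indicator_of_mem (s := Ioi 0) (ht.trans_lt h),
      Set.indicator_of_mem h]
  · rw [Set.indicator_of_notMem h, Set.indicator_apply_eq_zero]
    exact fun _ => by rw [Set.indicator_of_notMem h, zero_mul]

theorem gammaMeasure_one_Iic (n : ℕ) {t : ℝ} (ht : 0 ≤ t) :
    (gammaMeasure ((n + 1 : ℕ) : ℝ) 1).real (Iic t) = 1 - erlangTail (n + 1) t := by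
  have := isProbabilityMeasure_gammaMeasure (a := ((n + 1 : ℕ) : ℝ)) (r := 1) (by positivity) one_pos
  have hd : ∀ s ∈ Ici t, HasDerivAt (fun s => -erlangTail (n + 1) s)
      (s ^ n * Real.exp (-s) / n.factorial) s := fun s _ => by
    simpa using (hasDerivAt_erlangTail n s).fun_neg
  have hnn : ∀ s ∈ Ioi t, 0 ≤ s ^ n * Real.exp (-s) / n.factorial := fun s hs => by
    have : 0 < s := ht.trans_lt hs
    positivity
  have hlim : Tendsto (fun s => -erlangTail (n + 1) s) atTop (𝓝 0) := by
    simpa using (tendsto_erlangTail (n + 1)).neg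
  have hI := integral_Ioi_of_hasDerivAt_of_nonneg' hd hnn hlim
  have hint := integrableOn_Ioi_deriv_of_nonneg' hd hnn hlim
  have h1 : gammaMeasure ((n + 1 : ℕ) : ℝ) 1 (Ioi t) = ENNReal.ofReal (erlangTail (n + 1) t) := by
    rw [← lintegral_indicator_one measurableSet_Ioi,
      setLIntegral_Ioi_gammaMeasure_one n ht measurable_one]
    simp only [Pi.one_apply, one_mul]
    rw [← ofReal_integral_eq_lintegral_ofReal hint
      ((ae_restrict_iff' measurableSet_Ioi).mpr (Eventually.of_forall hnn)), hI]
    congr 1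
    ring
  rw [← compl_Ioi, probReal_compl_eq_one_sub measurableSet_Ioi, measureReal_def, h1,
    ENNReal.toReal_ofReal (erlangTail_nonneg _ ht)]

theorem exceedanceProb_nonneg (n b : ℕ) {u : ℝ} (h0 : 0 ≤ u) (h1 : u ≤ 1) :
    0 ≤ exceedanceProb n b u :=
  Finset.sum_nonneg fun l _ => by
    have := sub_nonneg.mpr h1
    positivity

theorem continuous_exceedanceProb (n b : ℕ) : Continuous (exceedanceProb n b) := by
  unfold exceedanceProb
  fun_prop

theorem erlangCdf_nonneg (n : ℕ) {t : ℝ} (ht : 0 ≤ t) : 0 ≤ 1 - erlangTail (n + 1) t := by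
  rw [← gammaMeasure_one_Iic n ht]
  exact measureReal_nonneg

theorem erlangCdf_le_one (n : ℕ) {t : ℝ} (ht : 0 ≤ t) : 1 - erlangTail (n + 1) t ≤ 1 := by
  linarith [erlangTail_nonneg (n + 1) ht]

/-- The probability that a block is fed back and its normalized CQI exceeds `t`. -/
theorem pi_bestBlocks_inter (n a b : ℕ) (hb : 1 ≤ b) (r : Fin (a + 1)) {t : ℝ} (ht : 0 ≤ t) :
    (Measure.pi fun _ : Fin (a + 1) => gammaMeasure ((n + 1 : ℕ) : ℝ) 1)
        {y | y ∈ bestBlocks b r ∧ t < y r} =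
      ENNReal.ofReal ((b : ℝ) / ((a : ℝ) + 1) *
        (1 - feedbackCdf (a + 1) b (1 - erlangTail (n + 1) t))) ∧
    0 ≤ (b : ℝ) / ((a : ℝ) + 1) * (1 - feedbackCdf (a + 1) b (1 - erlangTail (n + 1) t)) := by
  have := isProbabilityMeasure_gammaMeasure (a := ((n + 1 : ℕ) : ℝ)) (r := 1) (by positivity) one_pos
  set μ := gammaMeasure ((n + 1 : ℕ) : ℝ) 1 with hμ
  have hb0 : (b : ℝ) ≠ 0 := by positivity
  have hmeas : MeasurableSet {y : Fin (a + 1) → ℝ | y ∈ bestBlocks b r ∧ t < y r} :=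
    (measurableSet_bestBlocks b r).inter (measurableSet_lt measurable_const (measurable_pi_apply r))
  have hcdf : Measurable fun s => μ.real (Iic s) :=
    Monotone.measurable fun s s' h => measureReal_mono (Iic_subset_Iic.mpr h)
  have hq : Measurable fun s => ENNReal.ofReal (exceedanceProb a b (μ.real (Iic s))) :=
    ((continuous_exceedanceProb a b).measurable.comp hcdf).ennreal_ofReal
  have h1 : (Measure.pi fun _ : Fin (a + 1) => μ) {y | y ∈ bestBlocks b r ∧ t < y r} =
      ∫⁻ s, (Ioi t).indicator (fun s => ENNReal.ofReal (exceedanceProb a b (μ.real (Iic s)))) s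
        ∂μ := by
    have h := lintegral_indicator_bestBlocks μ a b r (g := (Ioi t).indicator 1)
      (measurable_one.indicator measurableSet_Ioi)
    rw [← lintegral_indicator_one hmeas]
    calc _ = _ := lintegral_congr fun y => by
            by_cases h1 : y ∈ bestBlocks b r <;> by_cases h2 : t < y r <;>
              simp [Set.indicator_apply, h1, h2]
      _ = _ := h
      _ = _ := lintegral_congr fun s => by
            by_cases h2 : t < s <;> simp [h2]
  -- The explicit antiderivative is `b / (a + 1)` times `feedbackCdf` composed with the Erlang
  -- distribution function; its limit at infinity is the feedback probability.
  have hd : ∀ s ∈ Ici t, HasDerivAt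
      (fun s => (b : ℝ) / ((a : ℝ) + 1) * feedbackCdf (a + 1) b (1 - erlangTail (n + 1) s))
      (exceedanceProb a b (1 - erlangTail (n + 1) s) * (s ^ n * Real.exp (-s) / n.factorial)) s := by
    intro s _
    have h2 := ((hasDerivAt_feedbackCdf a b hb (1 - erlangTail (n + 1) s)).comp s
      ((hasDerivAt_erlangTail n s).const_sub 1)).const_mul ((b : ℝ) / ((a : ℝ) + 1))
    refine h2.congr_deriv ?_
    field_simp
  have hnn : ∀ s ∈ Ioi t, 0 ≤ exceedanceProb a b (1 - erlangTail (n + 1) s) *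
      (s ^ n * Real.exp (-s) / n.factorial) := fun s hs => by
    have hs0 : 0 < s := ht.trans_lt hs
    have := exceedanceProb_nonneg a b (erlangCdf_nonneg n hs0.le) (erlangCdf_le_one n hs0.le)
    positivity
  have hlim : Tendsto
      (fun s => (b : ℝ) / ((a : ℝ) + 1) * feedbackCdf (a + 1) b (1 - erlangTail (n + 1) s)) atTop
      (𝓝 ((b : ℝ) / ((a : ℝ) + 1))) := by
    have h2 : Tendsto (fun s => 1 - erlangTail (n + 1) s) atTop (𝓝 1) := by
      simpa using (tendsto_erlangTail (n + 1)).const_sub 1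
    have h3 := (hasDerivAt_feedbackCdf a b hb 1).continuousAt.tendsto.comp h2
    rw [feedbackCdf_one _ _ hb] at h3
    simpa using h3.const_mul ((b : ℝ) / ((a : ℝ) + 1))
  have hI := integral_Ioi_of_hasDerivAt_of_nonneg' hd hnn hlim
  have hint := integrableOn_Ioi_deriv_of_nonneg' hd hnn hlim
  have hI' : (b : ℝ) / ((a : ℝ) + 1) * (1 - feedbackCdf (a + 1) b (1 - erlangTail (n + 1) t)) =
      ∫ s in Ioi t, exceedanceProb a b (1 - erlangTail (n + 1) s) *
        (s ^ n * Real.exp (-s) / n.factorial) := by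
    rw [hI]
    ring
  refine ⟨?_, ?_⟩
  · rw [h1, setLIntegral_Ioi_gammaMeasure_one n ht hq, hI', ofReal_integral_eq_lintegral_ofReal hint
      ((ae_restrict_iff' measurableSet_Ioi).mpr (Eventually.of_forall hnn))]
    refine setLIntegral_congr_fun measurableSet_Ioi fun s hs => ?_
    have hs0 : 0 ≤ s := ht.trans (le_of_lt hs)
    rw [gammaMeasure_one_Iic n hs0, ENNReal.ofReal_mul
      (exceedanceProb_nonneg a b (erlangCdf_nonneg n hs0) (erlangCdf_le_one n hs0))]
  · rw [hI']
    exact setIntegral_nonneg measurableSet_Ioi hnn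

theorem pi_notMem_bestBlocks_or_le (n a b : ℕ) (hb : 1 ≤ b) (r : Fin (a + 1)) {t : ℝ}
    (ht : 0 ≤ t) :
    (Measure.pi fun _ : Fin (a + 1) => gammaMeasure ((n + 1 : ℕ) : ℝ) 1)
        {y | y ∉ bestBlocks b r ∨ y r ≤ t} =
      ENNReal.ofReal (1 - (b : ℝ) / ((a : ℝ) + 1) *
        (1 - feedbackCdf (a + 1) b (1 - erlangTail (n + 1) t))) ∧
    0 ≤ 1 - (b : ℝ) / ((a : ℝ) + 1) *
      (1 - feedbackCdf (a + 1) b (1 - erlangTail (n + 1) t)) := by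
  have := isProbabilityMeasure_gammaMeasure (a := ((n + 1 : ℕ) : ℝ)) (r := 1) (by positivity) one_pos
  have hmeas : MeasurableSet {y : Fin (a + 1) → ℝ | y ∈ bestBlocks b r ∧ t < y r} :=
    (measurableSet_bestBlocks b r).inter (measurableSet_lt measurable_const (measurable_pi_apply r))
  obtain ⟨h, h0⟩ := pi_bestBlocks_inter n a b hb r ht
  have hc : {y : Fin (a + 1) → ℝ | y ∉ bestBlocks b r ∨ y r ≤ t} =
      {y | y ∈ bestBlocks b r ∧ t < y r}ᶜ := by
    ext y
    simp only [mem_ofPred_eq, mem_compl_iff, not_and_or, not_lt]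
  have hle : (b : ℝ) / ((a : ℝ) + 1) *
      (1 - feedbackCdf (a + 1) b (1 - erlangTail (n + 1) t)) ≤ 1 := by
    rw [← ENNReal.ofReal_le_one, ← h]
    exact prob_le_one
  refine ⟨?_, sub_nonneg.mpr hle⟩
  rw [hc, prob_compl_eq_one_sub hmeas, h, ENNReal.ofReal_sub _ h0, ENNReal.ofReal_one]

end GammaCdf

/-! ### The expected rate contributed by one user -/

section Rate

open Filter Topology Set
open scoped ENNReal NNReal

/-- The contribution of a user with mean SNR parameter `y` to the rate of a block. -/
noncomputable def userRate (N a b n : ℕ) (y : ℝ) : ℝ :=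
  (1 / (N : ℝ)) * ∑ m ∈ Finset.Icc 1 N,
    (N.choose m : ℝ) * ((b : ℝ) / a) ^ m * (1 - (b : ℝ) / a) ^ (N - m) *
      ∑ i ∈ Finset.range (m * (b - 1) + 1), e2 a b m i * C1 n y (m * a - i)

theorem integral_scheduled_density (N a b n : ℕ) (hb : 1 ≤ b) (hba : b ≤ a + 1) {y : ℝ}
    (hy : 0 < y) :
    IntegrableOn (fun t => Real.logb 2 (1 + t / y) *
      (exceedanceProb a b (1 - erlangTail (n + 1) t) *
        (1 - (b : ℝ) / ((a : ℝ) + 1) * (1 - feedbackCdf (a + 1) b (1 - erlangTail (n + 1) t))) ^ N) *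
      (t ^ n * Real.exp (-t) / n.factorial)) (Ioi 0) ∧
    ∫ t in Ioi (0 : ℝ), Real.logb 2 (1 + t / y) *
      (exceedanceProb a b (1 - erlangTail (n + 1) t) *
        (1 - (b : ℝ) / ((a : ℝ) + 1) * (1 - feedbackCdf (a + 1) b (1 - erlangTail (n + 1) t))) ^ N) *
      (t ^ n * Real.exp (-t) / n.factorial) = userRate (N + 1) (a + 1) b (n + 1) y := by
  -- Rate times the density of the maximum of `m * (a + 1) - i` normalized Gamma variables, so its
  -- integral is a value of `C1`.
  set φ : ℕ → ℕ → ℝ → ℝ := fun m i t =>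
    (((m * (a + 1) - i : ℕ) : ℝ) / ((n.factorial : ℝ) * Real.log 2)) * (Real.log (1 + t / y) *
      ((1 - erlangTail (n + 1) t) ^ (m * (a + 1) - i - 1) * (t ^ n * Real.exp (-t)))) with hφ
  have hφi : ∀ m i, IntegrableOn (φ m i) (Ioi 0) := fun m i =>
    (integrableOn_log_mul_maximum_density n _ hy).const_mul _
  have hφI : ∀ m ∈ Finset.Icc 1 (N + 1), ∀ i ∈ Finset.range (m * (b - 1) + 1),
      ∫ t in Ioi 0, φ m i t = C1 (n + 1) y (m * (a + 1) - i) := by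
    intro m hm i hi
    have hm' := (Finset.mem_Icc.mp hm).1
    have hi' := Finset.mem_range.mp hi
    have h1 : m * (b - 1) ≤ m * a := Nat.mul_le_mul_left _ (by omega)
    -- From `i ≤ m * (b - 1) ≤ m * a` the number of variables is at least `m ≥ 1`, so the natural
    -- subtraction is not truncated.
    obtain ⟨z, hz⟩ : ∃ z, m * (a + 1) - i = z + 1 := ⟨m * (a + 1) - i - 1, by
      rw [Nat.mul_add, mul_one]
      omega⟩
    simp only [hφ, hz, Nat.add_sub_cancel]
    rw [integral_const_mul, C1_eq_integral n z hy]
  have hsum : ∀ t ∈ Ioi (0 : ℝ), Real.logb 2 (1 + t / y) *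
      (exceedanceProb a b (1 - erlangTail (n + 1) t) *
        (1 - (b : ℝ) / ((a : ℝ) + 1) * (1 - feedbackCdf (a + 1) b (1 - erlangTail (n + 1) t))) ^ N) *
      (t ^ n * Real.exp (-t) / n.factorial) =
      (1 / ((N + 1 : ℕ) : ℝ)) * ∑ m ∈ Finset.Icc 1 (N + 1),
        (((N + 1).choose m : ℝ) * ((b : ℝ) / (a + 1 : ℕ)) ^ m *
          (1 - (b : ℝ) / (a + 1 : ℕ)) ^ (N + 1 - m)) *
          ∑ i ∈ Finset.range (m * (b - 1) + 1), e2 (a + 1) b m i * φ m i t := by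
    intro t ht
    have h := exceedanceProb_mul_pow (a + 1) b (N + 1) hb hba (by omega)
      (1 - erlangTail (n + 1) t) (sub_pos.mpr (erlangTail_lt_one ht))
    rw [Nat.add_sub_cancel, Nat.add_sub_cancel, Nat.cast_succ a] at h
    rw [h, Nat.cast_succ a, Real.logb]
    simp only [Finset.mul_sum, Finset.sum_mul, hφ]
    refine Finset.sum_congr rfl fun m _ => Finset.sum_congr rfl fun i _ => ?_
    ring
  have hint : ∀ m, IntegrableOn (fun t => (((N + 1).choose m : ℝ) * ((b : ℝ) / (a + 1 : ℕ)) ^ m *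
          (1 - (b : ℝ) / (a + 1 : ℕ)) ^ (N + 1 - m)) *
          ∑ i ∈ Finset.range (m * (b - 1) + 1), e2 (a + 1) b m i * φ m i t) (Ioi 0) := fun m =>
    (integrable_finsetSum _ fun i _ => (hφi m i).const_mul _).const_mul _
  constructor
  · refine IntegrableOn.congr_fun ?_ (fun t ht => (hsum t ht).symm) measurableSet_Ioi
    exact (integrable_finsetSum _ fun m _ => hint m).const_mul _
  · rw [setIntegral_congr_fun measurableSet_Ioi hsum, integral_const_mul,
      integral_finsetSum _ fun m _ => hint m, userRate]
    congr 1
    refine Finset.sum_congr rfl fun m hm => ?_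
    rw [integral_const_mul, integral_finsetSum _ fun i _ => (hφi m i).const_mul _]
    congr 1
    refine Finset.sum_congr rfl fun i hi => ?_
    rw [integral_const_mul, hφI m hm i hi]

/-- The expected rate of user `k` on block `r`, counted when it is scheduled. -/
theorem lintegral_rate_scheduled (N a b n : ℕ) (hb : 1 ≤ b) (hba : b ≤ a + 1)
    (r : Fin (a + 1)) (k : Fin (N + 1)) {y : ℝ} (hy : 0 < y) :
    ∫⁻ x, (scheduled b r k).indicator
        (fun x => ENNReal.ofReal (Real.logb 2 (1 + x k r / y))) x
        ∂(Measure.pi fun _ : Fin (N + 1) => Measure.pi fun _ : Fin (a + 1) =>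
          gammaMeasure ((n + 1 : ℕ) : ℝ) 1) =
      ENNReal.ofReal (userRate (N + 1) (a + 1) b (n + 1) y) ∧
    0 ≤ userRate (N + 1) (a + 1) b (n + 1) y := by
  have := isProbabilityMeasure_gammaMeasure (a := ((n + 1 : ℕ) : ℝ)) (r := 1) (by positivity) one_pos
  set μ := gammaMeasure ((n + 1 : ℕ) : ℝ) 1 with hμ
  have hlog : Measurable fun t : ℝ => ENNReal.ofReal (Real.logb 2 (1 + t / y)) := by
    unfold Real.logb
    fun_prop
  have hmono : Measurable fun t =>
      (Measure.pi fun _ : Fin (a + 1) => μ) {y | y ∉ bestBlocks b r ∨ y r ≤ t} :=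
    Monotone.measurable fun s t hst => measure_mono fun y hy => hy.imp id fun h => h.trans hst
  have hcdf : Measurable fun s => μ.real (Iic s) :=
    Monotone.measurable fun s s' h => measureReal_mono (Iic_subset_Iic.mpr h)
  have hq : Measurable fun s => ENNReal.ofReal (exceedanceProb a b (μ.real (Iic s))) :=
    ((continuous_exceedanceProb a b).measurable.comp hcdf).ennreal_ofReal
  obtain ⟨hint, hI⟩ := integral_scheduled_density N a b n hb hba hy
  have hlognn : ∀ t : ℝ, 0 ≤ t → 0 ≤ Real.logb 2 (1 + t / y) := fun t ht =>
    div_nonneg (log_one_add_div_nonneg ht hy) (Real.log_nonneg one_le_two)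
  have hnn : ∀ t ∈ Ioi (0 : ℝ), 0 ≤ Real.logb 2 (1 + t / y) *
      (exceedanceProb a b (1 - erlangTail (n + 1) t) *
        (1 - (b : ℝ) / ((a : ℝ) + 1) * (1 - feedbackCdf (a + 1) b (1 - erlangTail (n + 1) t))) ^ N) *
      (t ^ n * Real.exp (-t) / n.factorial) := by
    intro t ht
    have ht0 : 0 < t := ht
    have h1 := hlognn t ht0.le
    have h2 := exceedanceProb_nonneg a b (erlangCdf_nonneg n ht0.le) (erlangCdf_le_one n ht0.le)
    have h3 := (pi_notMem_bestBlocks_or_le n a b hb r ht0.le).2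
    exact mul_nonneg (mul_nonneg h1 (mul_nonneg h2 (pow_nonneg h3 _))) (by positivity)
  refine ⟨?_, hI ▸ setIntegral_nonneg measurableSet_Ioi hnn⟩
  refine (lintegral_indicator_scheduled μ N a b r k hlog).trans
    ((lintegral_gammaMeasure_one n ((hlog.mul (hmono.pow_const N)).mul hq)).trans ?_)
  rw [← hI, ofReal_integral_eq_lintegral_ofReal hint
      ((ae_restrict_iff' measurableSet_Ioi).mpr (Eventually.of_forall hnn))]
  refine setLIntegral_congr_fun measurableSet_Ioi fun t ht => ?_
  have ht0 : 0 < t := ht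
  have h1 := hlognn t ht0.le
  have h2 := exceedanceProb_nonneg a b (erlangCdf_nonneg n ht0.le) (erlangCdf_le_one n ht0.le)
  obtain ⟨h3, h4⟩ := pi_notMem_bestBlocks_or_le n a b hb r ht0.le
  simp only [Pi.mul_apply]
  rw [h3, gammaMeasure_one_Iic n ht0.le,
    ENNReal.ofReal_mul (mul_nonneg h1 (mul_nonneg h2 (pow_nonneg h4 _))), ENNReal.ofReal_mul h1,
    ENNReal.ofReal_mul h2, ENNReal.ofReal_pow h4]
  ring

end Rate

/-! ### Joint laws, absence of ties, and the pathwise scheduling identity -/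

section JointLaw

open Filter Topology Set

theorem hasLaw_curry {Ω ι κ E : Type*} [MeasurableSpace Ω] [MeasurableSpace E] [Fintype ι]
    [Fintype κ] {P : Measure Ω} {μ : ι → κ → Measure E} [∀ i j, IsProbabilityMeasure (μ i j)]
    {X : Ω → ι × κ → E} (hX : HasLaw X (Measure.pi fun p : ι × κ => μ p.1 p.2) P) :
    HasLaw (fun ω i j => X ω (i, j)) (Measure.pi fun i => Measure.pi fun j => μ i j) P := by
  have h : MeasurePreserving (MeasurableEquiv.curry ι κ E) (Measure.pi fun p : ι × κ => μ p.1 p.2)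
      (Measure.pi fun i => Measure.pi fun j => μ i j) := by
    refine ⟨MeasurableEquiv.measurable _, ?_⟩
    have := Measure.infinitePi_map_curry μ
    simpa only [Measure.infinitePi_eq_pi] using this
  exact h.comp_hasLaw hX

/-- A pair of independent atomless variables has a product law, for which the diagonal is null by
Fubini. -/
theorem ae_ne_of_iIndepFun {Ω ι : Type*} [MeasurableSpace Ω] [Fintype ι] {P : Measure Ω}
    [IsProbabilityMeasure P] {T : ι → Ω → ℝ} {μ : Measure ℝ} [IsProbabilityMeasure μ] [NullSingletonClass μ]
    (hT : ∀ p, HasLaw (T p) μ P) (hindep : iIndepFun T P) :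
    ∀ᵐ ω ∂P, ∀ p q, p ≠ q → T p ω ≠ T q ω := by
  rw [ae_all_iff]
  intro p
  rw [ae_all_iff]
  intro q
  by_cases hpq : p = q
  · exact Eventually.of_forall fun ω h => absurd hpq h
  have hlaw := (hindep.indepFun hpq).hasLaw_prod (hT p) (hT q)
  have hdiag : ∀ᵐ z ∂(μ.prod μ), z.1 ≠ z.2 := by
    refine (Measure.ae_prod_iff_ae_ae (p := fun z : ℝ × ℝ => z.1 ≠ z.2)
      (measurableSet_eq_fun measurable_fst measurable_snd).compl).mpr ?_
    refine Eventually.of_forall fun x => ?_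
    filter_upwards [compl_mem_ae_iff.mpr (measure_singleton (μ := μ) x)] with z hz h
    exact hz h.symm
  have := (hlaw.ae_iff (p := fun z : ℝ × ℝ => z.1 ≠ z.2)
    (measurableSet_setOfPred.1 (measurableSet_eq_fun measurable_fst measurable_snd).compl)).mpr hdiag
  filter_upwards [this] with ω hω _
  exact hω

/-- Without ties, the best blocks are those exceeded by fewer than `b` others. -/
theorem IsBest.mem_iff {a b : ℕ} {z y : Fin a → ℝ} {B : Finset (Fin a)} (hB : IsBest b z B)
    (hzy : ∀ r s, z r < z s ↔ y r < y s) (hinj : ∀ r s, r ≠ s → y r ≠ y s) (r : Fin a) :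
    r ∈ B ↔ y ∈ bestBlocks b r := by
  obtain ⟨hcard, hbest⟩ := hB
  have hle : ∀ r s, z r ≤ z s ↔ y r ≤ y s := fun r s => by
    rw [← not_lt, ← not_lt, hzy]
  change r ∈ B ↔ (Finset.univ.filter fun s => y r < y s).card < b
  constructor
  · intro hr
    rw [← hcard]
    -- Every block beating `r` lies in `B`, and `r` itself does not beat `r`, so the inclusion is
    -- strict.
    refine Finset.card_lt_card (Finset.ssubset_iff_subset_ne.mpr ⟨fun s hs => ?_, fun h => ?_⟩)
    · by_contra hsB
      have h1 := (hle s r).mp (hbest r hr s hsB)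
      exact absurd (Finset.mem_filter.mp hs).2 (not_lt.mpr h1)
    · rw [← h] at hr
      simp at hr
  · intro hlt
    by_contra hr
    rw [← hcard] at hlt
    -- If `r` were outside `B`, all `b` elements of `B` would beat it.
    refine absurd (Finset.card_le_card fun s hs => ?_) (not_le.mpr hlt)
    have h1 := (hle r s).mp (hbest s hs r hr)
    have hne : r ≠ s := fun h => hr (h ▸ hs)
    simpa using lt_of_le_of_ne h1 (hinj r s hne)

/-- Without ties, the rate of a block is the sum of the rates of its potential users. -/
theorem ofReal_logb_selectedSnr {N a b : ℕ} {c z w : Fin N → ℝ} {ρ : ℝ} {r : Fin a}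
    {x : Fin N → Fin a → ℝ} {S : Set (Fin N)} {o : Option (Fin N)} (ho : IsScheduled c z S o)
    (hS : ∀ k, k ∈ S ↔ x k ∈ bestBlocks b r)
    (hzx : ∀ j k, z j / c j ≤ z k / c k ↔ x j r ≤ x k r)
    (hinj : ∀ j k, j ≠ k → x j r ≠ x k r) (hw : ∀ k, ρ * z k = x k r / w k) :
    ENNReal.ofReal (Real.logb 2 (1 + selectedSnr ρ z o)) =
      ∑ k, (scheduled b r k).indicator
        (fun x => ENNReal.ofReal (Real.logb 2 (1 + x k r / w k))) x := by
  cases o with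
  | none =>
    have hS0 : S = ∅ := ho
    rw [Finset.sum_eq_zero]
    · simp [selectedSnr]
    · intro k _
      refine Set.indicator_of_notMem (fun h => ?_) _
      have := (hS k).mpr h.1
      simp [hS0] at this
  | some k =>
    obtain ⟨hk, hmax⟩ : k ∈ S ∧ ∀ j ∈ S, z j / c j ≤ z k / c k := ho
    rw [Finset.sum_eq_single k]
    · rw [Set.indicator_of_mem]
      · rw [selectedSnr, hw]
      · refine ⟨(hS k).mp hk, fun j _ => ?_⟩
        by_cases hj : j ∈ S
        · exact Or.inr ((hzx j k).mp (hmax j hj))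
        · exact Or.inl fun h => hj ((hS j).mpr h)
    · intro j _ hjk
      refine Set.indicator_of_notMem (fun h => ?_) _
      -- A second user in the scheduling event would have to tie with `k`.
      rcases h.2 k hjk.symm with h1 | h1
      · exact h1 ((hS k).mp hk)
      · exact hinj j k hjk (le_antisymm ((hzx j k).mp (hmax j ((hS j).mpr h.1))) h1)
    · simp

end JointLaw

end Ostbc

/-! ### The sum rate -/

theorem mainTheorem5 {Ω : Type*} [MeasurableSpace Ω] (P : Measure Ω) [IsProbabilityMeasure P]
    (N NRB NT NFB : ℕ) (hN : 1 ≤ N) (hNT : 1 ≤ NT) (hNFB : 1 ≤ NFB) (hle : NFB ≤ NRB)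
    (ρ : ℝ) (hρ : 0 < ρ) (c : Fin N → ℝ) (hc : ∀ k, 0 < c k)
    -- the channels `H k r i` between antenna `i` and user `k` on block `r`
    (H : Fin N → Fin NRB → Fin NT → Ω → ℂ)
    (hlaw : ∀ k r i, HasLaw (H k r i) (Ostbc.complexGaussian (c k)) P)
    (hindep : iIndepFun (fun p : Fin N × Fin NRB × Fin NT => H p.1 p.2.1 p.2.2) P)
    -- the CQI `Z k r` of user `k` on block `r`
    (Z : Fin N → Fin NRB → Ω → ℝ)
    (hZ : ∀ k r ω, Z k r ω = Ostbc.cqi (fun i => H k r i ω))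
    -- the set `B k ω` of blocks for which user `k` feeds back its CQI (ties broken in any way)
    (B : Fin N → Ω → Finset (Fin NRB))
    (hB : ∀ k ω, Ostbc.IsBest NFB (fun r => Z k r ω) (B k ω))
    -- the user `sel r ω` scheduled on block `r`, if any (ties broken in any way)
    (sel : Fin NRB → Ω → Option (Fin N))
    (hsel : ∀ r ω, Ostbc.IsScheduled c (fun k => Z k r ω) {k | r ∈ B k ω} (sel r ω))
    -- the SNR `X r` of the user selected on block `r`
    (X : Fin NRB → Ω → ℝ)
    (hX : ∀ r ω, X r ω = Ostbc.selectedSnr ρ (fun k => Z k r ω) (sel r ω)) :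
    (∀ k r, HasLaw (Z k r) (gammaMeasure NT (NT / c k)) P) ∧
    (∀ r, Integrable (fun ω => Real.logb 2 (1 + X r ω)) P) ∧
    (∀ r, Ostbc.sumRate P X = Ostbc.blockRate P (X r)) ∧
    Ostbc.sumRate P X =
      (1 / (N : ℝ)) * ∑ k, ∑ n ∈ Finset.Icc 1 N,
        (N.choose n : ℝ) * ((NFB : ℝ) / NRB) ^ n * (1 - (NFB : ℝ) / NRB) ^ (N - n) *
          ∑ m ∈ Finset.range (n * (NFB - 1) + 1),
            Ostbc.e2 NRB NFB n m * Ostbc.C1 NT (NT / (ρ * c k)) (n * NRB - m) ∧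
    (NFB = NRB →
      Ostbc.sumRate P X = (1 / (N : ℝ)) * ∑ k, Ostbc.C1 NT (NT / (ρ * c k)) N) ∧
    (NFB = 1 →
      Ostbc.sumRate P X =
        (1 / (N : ℝ)) * ∑ k, ∑ n ∈ Finset.Icc 1 N,
          (N.choose n : ℝ) * (1 / (NRB : ℝ)) ^ n * (1 - 1 / (NRB : ℝ)) ^ (N - n) *
            Ostbc.C1 NT (NT / (ρ * c k)) (n * NRB)) := by
  obtain ⟨N', rfl⟩ : ∃ N', N = N' + 1 := ⟨N - 1, by omega⟩
  obtain ⟨a, rfl⟩ : ∃ a, NRB = a + 1 := ⟨NRB - 1, by omega⟩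
  obtain ⟨n, rfl⟩ : ∃ n, NT = n + 1 := ⟨NT - 1, by omega⟩
  set μ := gammaMeasure ((n + 1 : ℕ) : ℝ) 1 with hμ
  have hprobμ : IsProbabilityMeasure μ := isProbabilityMeasure_gammaMeasure (by positivity) one_pos
  have hNT0 : (0 : ℝ) < ((n + 1 : ℕ) : ℝ) := by positivity
  have hHflat := (hindep.precomp (Equiv.prodAssoc (Fin (N' + 1)) (Fin (a + 1)) (Fin (n + 1))).injective).hasLaw_pi
    (fun p : (Fin (N' + 1) × Fin (a + 1)) × Fin (n + 1) => hlaw p.1.1 p.1.2 p.2)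
  have hHvec : HasLaw (fun ω (p : Fin (N' + 1) × Fin (a + 1)) i => H p.1 p.2 i ω)
      (Measure.pi fun p : Fin (N' + 1) × Fin (a + 1) =>
        Measure.pi fun _ : Fin (n + 1) => Ostbc.complexGaussian (c p.1)) P :=
    Ostbc.hasLaw_curry (μ := fun (p : Fin (N' + 1) × Fin (a + 1)) (_ : Fin (n + 1)) =>
      Ostbc.complexGaussian (c p.1)) hHflat
  have hHone : ∀ k r, HasLaw (fun ω i => H k r i ω)
      (Measure.pi fun _ : Fin (n + 1) => Ostbc.complexGaussian (c k)) P := fun k r =>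
    (measurePreserving_eval _ (k, r)).comp_hasLaw hHvec
  -- The factor `1 * c p.1` is the `r * v` of `map_sum_norm_sq_complexGaussian` at rate `r = 1`: all
  -- users get the same law.
  set T : Fin (N' + 1) × Fin (a + 1) → Ω → ℝ := fun p ω =>
    (1 / (1 * c p.1)) * ∑ i, ‖H p.1 p.2 i ω‖ ^ 2 with hT
  have hTvec : HasLaw (fun ω p => T p ω) (Measure.pi fun _ => μ) P := by
    have hmp : MeasurePreserving
        (fun (h : Fin (N' + 1) × Fin (a + 1) → Fin (n + 1) → ℂ) p =>
          (1 / (1 * c p.1)) * ∑ i, ‖h p i‖ ^ 2)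
        (Measure.pi fun p : Fin (N' + 1) × Fin (a + 1) =>
          Measure.pi fun _ : Fin (n + 1) => Ostbc.complexGaussian (c p.1))
        (Measure.pi fun _ => μ) :=
      measurePreserving_pi (f := fun p (h : Fin (n + 1) → ℂ) => (1 / (1 * c p.1)) * ∑ i, ‖h i‖ ^ 2)
        _ _ fun p : Fin (N' + 1) × Fin (a + 1) => ⟨by fun_prop,
        Ostbc.map_sum_norm_sq_complexGaussian n (hc p.1) one_pos⟩
    exact hmp.comp_hasLaw hHvec
  have hTone : ∀ p, HasLaw (T p) μ P := fun p => (measurePreserving_eval _ p).comp_hasLaw hTvec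
  have hTindep : iIndepFun T P := (iIndepFun_iff_hasLaw_pi_pi hTone).mpr hTvec
  have hTmat : HasLaw (fun ω k r => T (k, r) ω)
      (Measure.pi fun _ : Fin (N' + 1) => Measure.pi fun _ : Fin (a + 1) => μ) P :=
    Ostbc.hasLaw_curry (μ := fun _ _ => μ) hTvec
  have hatoms : NullSingletonClass μ := by
    rw [hμ, Ostbc.gammaMeasure_one_eq]
    infer_instance
  have hties := Ostbc.ae_ne_of_iIndepFun hTone hTindep
  have hZT : ∀ k r ω, Z k r ω = c k / ((n + 1 : ℕ) : ℝ) * T (k, r) ω := fun k r ω => by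
    have := (hc k).ne'
    simp only [hZ, Ostbc.cqi, hT]
    field_simp
  have hZlaw : ∀ k r, HasLaw (Z k r) (gammaMeasure ((n + 1 : ℕ) : ℝ) (((n + 1 : ℕ) : ℝ) / c k)) P := by
    intro k r
    have hmp : MeasurePreserving (fun h : Fin (n + 1) → ℂ =>
        (1 / (((n + 1 : ℕ) : ℝ) / c k * c k)) * ∑ i, ‖h i‖ ^ 2)
        (Measure.pi fun _ : Fin (n + 1) => Ostbc.complexGaussian (c k))
        (gammaMeasure ((n + 1 : ℕ) : ℝ) (((n + 1 : ℕ) : ℝ) / c k)) :=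
      ⟨by fun_prop, Ostbc.map_sum_norm_sq_complexGaussian n (hc k) (div_pos hNT0 (hc k))⟩
    convert hmp.comp_hasLaw (hHone k r) using 1
    funext ω
    simp only [hZ, Ostbc.cqi, Function.comp]
    rw [div_mul_cancel₀ _ (hc k).ne']
  set y : Fin (N' + 1) → ℝ := fun k => ((n + 1 : ℕ) : ℝ) / (ρ * c k) with hy
  have hy0 : ∀ k, 0 < y k := fun k => div_pos hNT0 (mul_pos hρ (hc k))
  have hrate0 : ∀ k, 0 ≤ Ostbc.userRate (N' + 1) (a + 1) NFB (n + 1) (y k) := fun k =>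
    (Ostbc.lintegral_rate_scheduled N' a NFB n hNFB hle 0 k (hy0 k)).2
  -- No measurability of `B` or `sel` is assumed. The rate agrees almost everywhere with the
  -- measurable function `F` of the matrix `T`, which yields both its measurability and its
  -- integral.
  set F : Fin (a + 1) → (Fin (N' + 1) → Fin (a + 1) → ℝ) → ENNReal := fun r x =>
    ∑ k, (Ostbc.scheduled NFB r k).indicator
      (fun x => ENNReal.ofReal (Real.logb 2 (1 + x k r / y k))) x with hF
  have hFterm : ∀ (r : Fin (a + 1)) (k : Fin (N' + 1)), Measurable ((Ostbc.scheduled NFB r k).indicator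
      (fun x => ENNReal.ofReal (Real.logb 2 (1 + x k r / y k)))) := fun r k => by
    refine Measurable.indicator ?_ (Ostbc.measurableSet_scheduled NFB r k)
    unfold Real.logb
    fun_prop
  have hFm : ∀ r, Measurable (F r) := fun r => Finset.measurable_fun_sum _ fun k _ => hFterm r k
  have hae : ∀ r, (fun ω => ENNReal.ofReal (Real.logb 2 (1 + X r ω))) =ᵐ[P]
      fun ω => F r fun k r => T (k, r) ω := by
    intro r
    filter_upwards [hties] with ω hω
    rw [hX]
    refine Ostbc.ofReal_logb_selectedSnr (x := fun k r => T (k, r) ω) (hsel r ω) (fun k => ?_)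
      (fun j k => ?_) (fun j k hjk => hω _ _ (by simpa using hjk)) (fun k => ?_)
    · refine (hB k ω).mem_iff (fun r s => ?_) (fun r s hrs => hω _ _ (by simpa using hrs)) r
      rw [hZT, hZT, mul_lt_mul_iff_right₀ (div_pos (hc k) hNT0)]
    · simp only [hZT]
      have hdiv : ∀ k, c k / ((n + 1 : ℕ) : ℝ) * T (k, r) ω / c k =
          T (k, r) ω / ((n + 1 : ℕ) : ℝ) := fun k => by
        have := (hc k).ne'
        field_simp
      rw [hdiv, hdiv, div_le_div_iff_of_pos_right hNT0]
    · have := (hc k).ne'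
      simp only [hZT, hy]
      field_simp
  have hXnn : ∀ r ω, 0 ≤ X r ω := by
    intro r ω
    rw [hX]
    cases sel r ω with
    | none => exact le_rfl
    | some k =>
      simp only [Ostbc.selectedSnr, hZ, Ostbc.cqi]
      positivity
  have hlognn : ∀ r ω, 0 ≤ Real.logb 2 (1 + X r ω) := fun r ω =>
    Real.logb_nonneg one_lt_two (by linarith [hXnn r ω])
  have hlint : ∀ r, ∫⁻ ω, ENNReal.ofReal (Real.logb 2 (1 + X r ω)) ∂P =
      ENNReal.ofReal (∑ k, Ostbc.userRate (N' + 1) (a + 1) NFB (n + 1) (y k)) := by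
    intro r
    rw [lintegral_congr_ae (hae r), hTmat.lintegral_comp (f := F r) (hFm r).aemeasurable,
      lintegral_finsetSum _ fun k _ => hFterm r k, ENNReal.ofReal_sum_of_nonneg fun k _ => hrate0 k]
    exact Finset.sum_congr rfl fun k _ =>
      (Ostbc.lintegral_rate_scheduled N' a NFB n hNFB hle r k (hy0 k)).1
  have haem : ∀ r, AEStronglyMeasurable (fun ω => Real.logb 2 (1 + X r ω)) P := by
    intro r
    have h1 : AEMeasurable (fun ω => ENNReal.ofReal (Real.logb 2 (1 + X r ω))) P :=
      ((hFm r).comp_aemeasurable hTmat.aemeasurable).congr (hae r).symm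
    have h2 := h1.ennreal_toReal
    simp only [ENNReal.toReal_ofReal (hlognn r _)] at h2
    exact h2.aestronglyMeasurable
  have hblock : ∀ r, Ostbc.blockRate P (X r) =
      ∑ k, Ostbc.userRate (N' + 1) (a + 1) NFB (n + 1) (y k) := by
    intro r
    rw [Ostbc.blockRate, integral_eq_lintegral_of_nonneg_ae
      (Filter.Eventually.of_forall (hlognn r)) (haem r), hlint,
      ENNReal.toReal_ofReal (Finset.sum_nonneg fun k _ => hrate0 k)]
  have hsumrate : Ostbc.sumRate P X =
      ∑ k, Ostbc.userRate (N' + 1) (a + 1) NFB (n + 1) (y k) := by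
    rw [Ostbc.sumRate]
    simp only [hblock]
    rw [Finset.sum_const, Finset.card_univ, Fintype.card_fin, nsmul_eq_mul]
    field_simp
  refine ⟨hZlaw, fun r => ?_, fun r => by rw [hsumrate, hblock], ?_, fun hfull => ?_, fun hone => ?_⟩
  · refine ⟨haem r, ?_⟩
    rw [hasFiniteIntegral_iff_ofReal (Filter.Eventually.of_forall (hlognn r)), hlint]
    exact ENNReal.ofReal_lt_top
  · rw [hsumrate, Finset.mul_sum]
    rfl
  · rw [hsumrate, Finset.mul_sum]
    refine Finset.sum_congr rfl fun k _ => ?_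
    -- With `p = 1` the factor `0 ^ (N - n)` leaves only `n = N`; there `e2_self` leaves the top
    -- `m`, for which `n * NRB - m = N`.
    rw [Ostbc.userRate, hfull, Finset.sum_eq_single (N' + 1)]
    · rw [Finset.sum_eq_single ((N' + 1) * (a + 1 - 1)),
        Ostbc.e2_self _ _ _ (by omega) (by omega) le_rfl, if_pos rfl]
      · have h1 : (((a + 1 : ℕ) : ℝ) / ((a + 1 : ℕ) : ℝ)) = 1 := div_self (by positivity)
        have h2 : (N' + 1) * (a + 1) - (N' + 1) * (a + 1 - 1) = N' + 1 := by
          rw [Nat.add_sub_cancel, Nat.mul_add]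
          omega
        rw [h1, h2]
        simp [hy]
      · intro m hm hne
        rw [Ostbc.e2_self _ _ _ (by omega) (by omega) (by simpa [Nat.lt_succ_iff] using hm),
          if_neg hne, zero_mul]
      · simp
    · intro m hm hne
      have hm' := Finset.mem_Icc.mp hm
      rw [div_self (by positivity), sub_self, zero_pow (by omega)]
      simp
    · simp
  · rw [hsumrate, Finset.mul_sum]
    refine Finset.sum_congr rfl fun k _ => ?_
    rw [Ostbc.userRate, hone]
    congr 1
    refine Finset.sum_congr rfl fun m _ => ?_
    -- For best-1 feedback the inner sum has only the term `m = 0`, with coefficient one.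
    have h1 : Ostbc.e1 (a + 1) 1 0 = 1 := by simp [Ostbc.e1]
    have h2 : Ostbc.e2 (a + 1) 1 m 0 = 1 := by
      rw [Ostbc.e2, if_pos rfl, h1, one_pow]
    simp [h2, hy]
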